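/- For $k\ge 0$ let $\Sigma_k$ be an alphabet with $k$ letters, and consider the regular expressions with shuffle generated by $$\alpha \to \varepsilon \mid a \mid \alpha+\alpha \mid \alpha\cdot\alpha \mid \alpha ⧢ \alpha \mid \alpha^\star \qquad (a\in\Sigma_k).$$ The size of $\alpha$ is its number of symbols (letters, $\varepsilon$ and operators, including concatenation, but no parentheses), and $|\alpha|_\Sigma$ is its number of occurrences of letters. For sets $S,T$ of expressions and an expression $\beta\neq\varepsilon$ put $S\beta=\{\gamma\beta\mid\gamma\in S\}$ and $S⧢ T=\{\gamma⧢\delta\mid\gamma\in S,\delta\in T\}$, with the conventions $S\varepsilon=S$ and $\varepsilon⧢\gamma=\gamma⧢\varepsilon=\gamma$. The set $\pi(\alpha)$ is defined by $\pi(\varepsilon)=\emptyset$, $\pi(a)=\{\varepsilon\}$, $\pi(\alpha^\star)=\pi(\alpha)\alpha^\star$, $\pi(\alpha+\beta)=\pi(\alpha)\cup\pi(\beta)$, $\pi(\alpha\beta)=\pi(\alpha)\beta\cup\pi(\beta)$ and $\pi(\alpha⧢\beta)=\pi(\alpha)⧢\pi(\beta)\,\cup\,\pi(\alpha)⧢\{\beta\}\,\cup\,\{\alpha\}⧢\pi(\beta)$.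 Let $p(\alpha)$ be the number obtained by counting all these unions as disjoint: $p(\varepsilon)=0$, $p(a)=1$, $p(\alpha^\star)=p(\alpha)$, $p(\alpha+\beta)=p(\alpha\beta)=p(\alpha)+p(\beta)$, $p(\alpha⧢\beta)=p(\alpha)p(\beta)+p(\alpha)+p(\beta)$. The partial derivatives of an expression by a letter $a$ are $\partial_a(\varepsilon)=\emptyset$, $\partial_a(b)=\{\varepsilon\}$ if $b=a$ and $\emptyset$ otherwise, $\partial_a(\alpha^\star)=\partial_a(\alpha)\alpha^\star$, $\partial_a(\alpha+\beta)=\partial_a(\alpha)\cup\partial_a(\beta)$, $\partial_a(\alpha\beta)=\partial_a(\alpha)\beta$, together with $\partial_a(\beta)$ if the language of $\alpha$ contains the empty word, and $\partial_a(\alpha⧢\beta)=\partial_a(\alpha)⧢\{\beta\}\cup\{\alpha\}⧢\partial_a(\beta)$. For words, $\partial_\varepsilon(\alpha)=\{\alpha\}$ and $\partial_{xa}(\alpha)=\bigcup_{\gamma\in\partial_x(\alpha)}\partial_a(\gamma)$. The partial derivative automaton $\mathcal A_{pd}(\alpha)$ has state set $\partial(\alpha)=\bigcup_{x\in\Sigma_k^\star}\partial_x(\alpha)$,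 initial state $\alpha$, transitions $(\gamma,a)\mapsto\partial_a(\gamma)$, and as final states those $\gamma\in\partial(\alpha)$ whose language contains the empty word. Let $avP$, $avL$ and $avS$ be the averages of $p(\alpha)$, of $|\alpha|_\Sigma$ and of the number of states of $\mathcal A_{pd}(\alpha)$, where $\alpha$ is uniformly random among the expressions of size $n$ over $\Sigma_k$. Then: 1. For every $\alpha$, the sets $\pi(\alpha)$ and $\partial(\alpha)$ are finite, $|\pi(\alpha)|\le p(\alpha)$, and $\mathcal A_{pd}(\alpha)$ has at most $p(\alpha)+1$ states. 2. $$\lim_{n,k\to\infty}\frac{\log_2 avP}{avL}=\log_2\frac43 \qquad\text{and}\qquad \lim_{n,k\to\infty} avP^{\,1/avL}=\frac43,$$ where $n$ and $k$ tend to infinity jointly and independently of each other. 3. For large $n$ and $k$, an upper bound for the average number of states of $\mathcal A_{pd}$ is $(4/3)^{avL}$: there are $N,K$ such that $avS\le(4/3)^{avL}$ for all $n\ge N$ and $k\ge K$. -/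

import Mathlib

open Filter Topology

/-- Regular expressions with shuffle over the alphabet `A`, without the constant for the empty
language: `α → ε | a | α + α | α · α | α ⧢ α | α*`. -/
inductive ShuffleExpr (A : Type) : Type
  | eps : ShuffleExpr A
  | letter : A → ShuffleExpr A
  | plus : ShuffleExpr A → ShuffleExpr A → ShuffleExpr A
  | concat : ShuffleExpr A → ShuffleExpr A → ShuffleExpr A
  | shuffle : ShuffleExpr A → ShuffleExpr A → ShuffleExpr A
  | star : ShuffleExpr A → ShuffleExpr A

namespace ShuffleExpr

variable {A : Type}

/-- The size: the number of symbols (letters, `ε`, operators), parentheses not counted. -/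
def size : ShuffleExpr A → ℕ
  | eps => 1
  | letter _ => 1
  | plus α β => size α + size β + 1
  | concat α β => size α + size β + 1
  | shuffle α β => size α + size β + 1
  | star α => size α + 1

/-- The number `|α|_Σ` of occurrences of letters. -/
def letters : ShuffleExpr A → ℕ
  | eps => 0
  | letter _ => 1
  | plus α β => letters α + letters β
  | concat α β => letters α + letters β
  | shuffle α β => letters α + letters β
  | star α => letters α

/-- `ε(α) = ε`, that is, the language of `α` contains the empty word. -/
def Nullable : ShuffleExpr A → Prop
  | eps => True
  | letter _ => False
  | plus α β => Nullable α ∨ Nullable β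
  | concat α β => Nullable α ∧ Nullable β
  | shuffle α β => Nullable α ∧ Nullable β
  | star _ => True

/-- The product `γ β`, with the convention `γ ε = γ`. -/
def cat : ShuffleExpr A → ShuffleExpr A → ShuffleExpr A
  | γ, eps => γ
  | γ, β => concat γ β

/-- The shuffle `γ ⧢ δ`, with the convention `ε ⧢ δ = δ` and `γ ⧢ ε = γ`. -/
def shuf : ShuffleExpr A → ShuffleExpr A → ShuffleExpr A
  | eps, δ => δ
  | γ, eps => γ
  | γ, δ => shuffle γ δ

/-- `S β = {γ β | γ ∈ S}`. -/
def setCat (S : Set (ShuffleExpr A)) (β : ShuffleExpr A) : Set (ShuffleExpr A) :=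
  {δ | ∃ γ ∈ S, δ = cat γ β}

/-- `S ⧢ T = {γ ⧢ δ | γ ∈ S, δ ∈ T}`. -/
def setShuf (S T : Set (ShuffleExpr A)) : Set (ShuffleExpr A) :=
  {η | ∃ γ ∈ S, ∃ δ ∈ T, η = shuf γ δ}

/-- The support `π(α)`. -/
def support : ShuffleExpr A → Set (ShuffleExpr A)
  | eps => ∅
  | letter _ => {eps}
  | plus α β => support α ∪ support β
  | concat α β => setCat (support α) β ∪ support β
  | shuffle α β =>
      setShuf (support α) (support β) ∪ setShuf (support α) {β} ∪ setShuf {α} (support β)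
  | star α => setCat (support α) (star α)

/-- The bound `p(α)` on `|π(α)|` obtained by counting all unions in the definition of `π`
as disjoint. -/
def supportBound : ShuffleExpr A → ℕ
  | eps => 0
  | letter _ => 1
  | plus α β => supportBound α + supportBound β
  | concat α β => supportBound α + supportBound β
  | shuffle α β => supportBound α * supportBound β + supportBound α + supportBound β
  | star α => supportBound α

/-- The set `∂_a(α)` of partial derivatives with respect to the letter `a`. -/
def pderiv (a : A) : ShuffleExpr A → Set (ShuffleExpr A)
  | eps => ∅
  | letter b => {γ | b = a ∧ γ = eps}
  | plus α β => pderiv a α ∪ pderiv a β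
  | concat α β => setCat (pderiv a α) β ∪ {γ | Nullable α ∧ γ ∈ pderiv a β}
  | shuffle α β => setShuf (pderiv a α) {β} ∪ setShuf {α} (pderiv a β)
  | star α => setCat (pderiv a α) (star α)

/-- The set `∂_x(α)` of partial derivatives with respect to the word `x`:
`∂_ε(α) = {α}` and `∂_{xa}(α) = ∂_a(∂_x(α))`. -/
def pderivWord (α : ShuffleExpr A) (x : List A) : Set (ShuffleExpr A) :=
  x.foldl (fun S a => ⋃ γ ∈ S, pderiv a γ) {α}

/-- The set `∂(α)` of all partial derivatives of `α`. -/
def pderivs (α : ShuffleExpr A) : Set (ShuffleExpr A) :=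
  ⋃ x : List A, pderivWord α x

/-- The partial derivative automaton of `α`; its set of states is `∂(α)`. -/
def pdAutomaton (α : ShuffleExpr A) : NFA A (pderivs α) where
  step γ a := {δ | (δ : ShuffleExpr A) ∈ pderiv a (γ : ShuffleExpr A)}
  start := {γ | (γ : ShuffleExpr A) = α}
  accept := {γ | Nullable (γ : ShuffleExpr A)}

/-- The number of states of an automaton with finitely many states. -/
noncomputable def numStates {B σ : Type} (_M : NFA B σ) : ℕ := Nat.card σ

theorem finite_size_le [Finite A] (n : ℕ) : {α : ShuffleExpr A | size α ≤ n}.Finite := by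
  induction n with
  | zero =>
    refine Set.Finite.subset Set.finite_empty ?_
    intro α h
    cases α <;> simp [size] at h
  | succ n ih =>
    refine Set.Finite.subset
      ((((((Set.finite_singleton (eps : ShuffleExpr A)).union
        (Set.finite_range (letter : A → ShuffleExpr A))).union
        (Set.Finite.image2 plus ih ih)).union (Set.Finite.image2 concat ih ih)).union
        (Set.Finite.image2 shuffle ih ih)).union (Set.Finite.image star ih)) ?_
    intro α h
    cases α with
    | eps => simp
    | letter a => simp
    | plus α β =>
      have h : size α + size β + 1 ≤ n + 1 := h
      exact Or.inl (Or.inl (Or.inl (Or.inr ⟨α, by simp; omega, β, by simp; omega, rfl⟩)))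
    | concat α β =>
      have h : size α + size β + 1 ≤ n + 1 := h
      exact Or.inl (Or.inl (Or.inr ⟨α, by simp; omega, β, by simp; omega, rfl⟩))
    | shuffle α β =>
      have h : size α + size β + 1 ≤ n + 1 := h
      exact Or.inl (Or.inr ⟨α, by simp; omega, β, by simp; omega, rfl⟩)
    | star α =>
      have h : size α + 1 ≤ n + 1 := h
      exact Or.inr ⟨α, by simp; omega, rfl⟩

theorem finite_size_eq (A : Type) [Finite A] (n : ℕ) :
    {α : ShuffleExpr A | size α = n}.Finite :=
  (finite_size_le n).subset fun _ h => le_of_eq h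

/-- The finite set of expressions of size `n` over the alphabet `Fin k`. -/
noncomputable def ofSize (k n : ℕ) : Finset (ShuffleExpr (Fin k)) :=
  (finite_size_eq (Fin k) n).toFinset

/-- The average of `f` over the expressions of size `n` over the alphabet `Fin k`, all of
them equally likely. -/
noncomputable def average (k n : ℕ) (f : ShuffleExpr (Fin k) → ℕ) : ℝ :=
  (∑ α ∈ ofSize k n, (f α : ℝ)) / ((ofSize k n).card : ℝ)

/-- The average of `p(α)`. -/
noncomputable def avP (k n : ℕ) : ℝ := average k n supportBound

/-- The average number of letters. -/
noncomputable def avL (k n : ℕ) : ℝ := average k n letters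

/-- The average number of states of the partial derivative automaton. -/
noncomputable def avStates (k n : ℕ) : ℝ := average k n fun α => numStates (pdAutomaton α)

end ShuffleExpr

/-!
The support `π(α)` contains the partial derivatives of `α` by letters and, with each of its
elements, the support of that element; so the states of the partial derivative automaton form a
subset of `π(α) ∪ {α}`, and counting the unions of `π` as disjoint gives `p(α)`.

*Averages as Motzkin polynomials.* Let `M n` be the polynomial counting unary-binary trees with `n`
nodes by their leaves, `∑ b, choose (n - 1) (2 b) * catalan b * X ^ (b + 1)`, and let
`t = 3 (k + 1)`. There are `M n (t) / 3` expressions of size `n`: the factor `3` for the choice of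
each binary operation is absorbed into the leaf weights. The same works for `p(α) + 3`, which a
star leaves unchanged and which the three binary operations together multiply, so that its sum is
`M n (t + k)`; marking a letter amounts to differentiating `M n`. Hence
`avP = 3 (M n (τ t) / M n (t) - 1)` with `τ = 1 + k / t`, which tends to `4 / 3`, and
`avL = k / (k + 1) * E`, where `E` is the mean number of leaves (`avP_succ`, `avL_succ`).

*Uniform asymptotics.* Trading two unary nodes for a binary one shows that the mean number of unary
nodes is at most `1 + 2 n / √t` (`sum_unary_mul_motzkinTerm_le`), so `E / n` tends to `1 / 2`
jointly in `n` and `k`. As no tree has more than `(n + 1) / 2` leaves, `M n (τ t) / M n (t)` is at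
most `τ ^ ((n + 1) / 2)`; by Jensen's inequality it is at least `τ ^ E`. This gives
`log avP / n → log (4 / 3) / 2` and the two limits.

*The number of states.* For fixed large `k`, the number `avP` grows slightly faster in `n` than
`(4 / 3) ^ avL`, so the last claim does not follow from the bound by `p(α) + 1`. It follows from
counting the support of a sum of two leaves, which is at most `{ε}`, once only (`refinedBound`).
The sums of the refined bound satisfy the same recurrence with a correction for such sums, and
evaluating their generating function at a suitable point shows that they grow like `(53 / 40) ^ b`
instead of `(4 / 3) ^ b` in the number `b` of binary operations, relative to the number of
expressions. The loss incurred by that evaluation is exponential in the number of stars only, and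
an exponential moment bound for that number (`pow_unary_mul_motzkinTerm_le`) makes it negligible.
-/

open Finset.HasAntidiagonal (antidiagonal)

namespace ShuffleExpr

variable {A : Type}

/-! ### The support and the partial derivatives -/

theorem cat_eq_concat {β : ShuffleExpr A} (hβ : β ≠ eps) (γ : ShuffleExpr A) :
    cat γ β = concat γ β := by
  cases β <;> first | rfl | exact absurd rfl hβ

theorem eps_shuf (δ : ShuffleExpr A) : shuf eps δ = δ := by
  cases δ <;> rfl

theorem shuf_eps (γ : ShuffleExpr A) : shuf γ eps = γ := by
  cases γ <;> rfl

theorem shuf_eq_shuffle {γ δ : ShuffleExpr A} (hγ : γ ≠ eps) (hδ : δ ≠ eps) :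
    shuf γ δ = shuffle γ δ := by
  cases γ <;> cases δ <;> first | rfl | exact absurd rfl hγ | exact absurd rfl hδ

theorem setCat_eq_image (S : Set (ShuffleExpr A)) (β : ShuffleExpr A) :
    setCat S β = (fun γ => cat γ β) '' S := by
  ext δ
  simp [setCat, eq_comm]

theorem setShuf_eq_image2 (S T : Set (ShuffleExpr A)) : setShuf S T = Set.image2 shuf S T := by
  ext δ
  simp [setShuf, eq_comm]

theorem setCat_mono {S S' : Set (ShuffleExpr A)} (h : S ⊆ S') (β : ShuffleExpr A) :
    setCat S β ⊆ setCat S' β :=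
  fun _ ⟨γ, hγ, e⟩ => ⟨γ, h hγ, e⟩

theorem setShuf_mono {S S' T T' : Set (ShuffleExpr A)} (hS : S ⊆ S') (hT : T ⊆ T') :
    setShuf S T ⊆ setShuf S' T' :=
  fun _ ⟨γ, hγ, δ, hδ, e⟩ => ⟨γ, hS hγ, δ, hT hδ, e⟩

theorem finite_support (α : ShuffleExpr A) : α.support.Finite := by
  induction α with
  | eps => exact Set.finite_empty
  | letter a => exact Set.finite_singleton _
  | plus α β hα hβ => exact hα.union hβ
  | concat α β hα hβ =>
    simp only [support, setCat_eq_image]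
    exact (hα.image _).union hβ
  | shuffle α β hα hβ =>
    simp only [support, setShuf_eq_image2]
    exact ((hα.image2 _ hβ).union (hα.image2 _ (Set.finite_singleton _))).union
      ((Set.finite_singleton _).image2 _ hβ)
  | star α hα =>
    simp only [support, setCat_eq_image]
    exact hα.image _

theorem ncard_setCat_le {S : Set (ShuffleExpr A)} (hS : S.Finite) (β : ShuffleExpr A) :
    (setCat S β).ncard ≤ S.ncard := by
  rw [setCat_eq_image]
  exact Set.ncard_image_le hS

theorem ncard_setShuf_le {S T : Set (ShuffleExpr A)} (hS : S.Finite) (hT : T.Finite) :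
    (setShuf S T).ncard ≤ S.ncard * T.ncard := by
  rw [setShuf_eq_image2, ← Set.image_prod, ← Set.ncard_prod]
  exact Set.ncard_image_le (hS.prod hT)

theorem ncard_support_shuffle_le (α β : ShuffleExpr A) :
    (shuffle α β).support.ncard ≤
      α.support.ncard * β.support.ncard + α.support.ncard + β.support.ncard := by
  have hα := α.finite_support
  have hβ := β.finite_support
  have h₁ := ncard_setShuf_le hα hβ
  have h₂ := ncard_setShuf_le hα (Set.finite_singleton β)
  have h₃ := ncard_setShuf_le (Set.finite_singleton α) hβ
  have h₄ := Set.ncard_union_le (setShuf α.support β.support ∪ setShuf α.support {β})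
    (setShuf {α} β.support)
  have h₅ := Set.ncard_union_le (setShuf α.support β.support) (setShuf α.support {β})
  simp only [Set.ncard_singleton, mul_one, one_mul] at h₂ h₃
  simp only [support]
  omega

theorem ncard_support_concat_le (α β : ShuffleExpr A) :
    (concat α β).support.ncard ≤ α.support.ncard + β.support.ncard :=
  (Set.ncard_union_le _ _).trans (Nat.add_le_add_right (ncard_setCat_le α.finite_support β) _)

theorem ncard_support_le_supportBound (α : ShuffleExpr A) :
    α.support.ncard ≤ α.supportBound := by
  induction α with
  | eps => simp [support, supportBound]
  | letter a => simp [support, supportBound]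
  | plus α β hα hβ => exact (Set.ncard_union_le _ _).trans (add_le_add hα hβ)
  | concat α β hα hβ => exact (ncard_support_concat_le α β).trans (add_le_add hα hβ)
  | shuffle α β hα hβ =>
    refine (ncard_support_shuffle_le α β).trans ?_
    simp only [supportBound]
    gcongr
  | star α hα => exact (ncard_setCat_le α.finite_support _).trans hα

theorem pderiv_subset_support (a : A) (α : ShuffleExpr A) : pderiv a α ⊆ α.support := by
  induction α with
  | eps => exact Set.Subset.rfl
  | letter b => exact fun γ h => h.2
  | plus α β hα hβ => exact Set.union_subset_union hα hβ
  | concat α β hα hβ =>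
    exact Set.union_subset_union (setCat_mono hα β) fun γ h => hβ h.2
  | shuffle α β hα hβ =>
    exact Set.union_subset_union
      ((setShuf_mono hα Set.Subset.rfl).trans Set.subset_union_right)
      (setShuf_mono Set.Subset.rfl hβ)
  | star α hα => exact setCat_mono hα _

theorem support_cat_subset (γ β : ShuffleExpr A) :
    (cat γ β).support ⊆ setCat γ.support β ∪ β.support := by
  by_cases h : β = eps
  · subst h
    exact fun δ hδ => Or.inl ⟨δ, hδ, rfl⟩
  · rw [cat_eq_concat h]
    exact Set.Subset.rfl

theorem support_shuf_subset (γ δ : ShuffleExpr A) :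
    (shuf γ δ).support ⊆ setShuf γ.support δ.support ∪ setShuf γ.support {δ} ∪
      setShuf {γ} δ.support := by
  by_cases hγ : γ = eps
  · subst hγ
    rw [eps_shuf]
    exact fun η hη => Or.inr ⟨eps, rfl, η, hη, (eps_shuf η).symm⟩
  by_cases hδ : δ = eps
  · subst hδ
    rw [shuf_eps]
    exact fun η hη => Or.inl (Or.inr ⟨η, hη, eps, rfl, (shuf_eps η).symm⟩)
  rw [shuf_eq_shuffle hγ hδ]
  exact Set.Subset.rfl

/-- The support is transitive; with `pderiv_subset_support` this makes `α` together with its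
support closed under partial derivatives. -/
theorem support_subset_of_mem_support {α γ : ShuffleExpr A} (h : γ ∈ α.support) :
    γ.support ⊆ α.support := by
  induction α generalizing γ with
  | eps => exact absurd h (Set.notMem_empty _)
  | letter a =>
    rw [Set.mem_singleton_iff.mp h]
    exact Set.empty_subset _
  | plus α β hα hβ =>
    exact h.elim (fun h => (hα h).trans Set.subset_union_left)
      fun h => (hβ h).trans Set.subset_union_right
  | concat α β hα hβ =>
    rcases h with ⟨γ', h', rfl⟩ | h
    · exact (support_cat_subset _ _).trans
        (Set.union_subset_union (setCat_mono (hα h') β) Set.Subset.rfl)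
    · exact (hβ h).trans Set.subset_union_right
  | shuffle α β hα hβ =>
    rcases h with (⟨γ', hγ, δ, hδ, rfl⟩ | ⟨γ', hγ, δ, hδ, rfl⟩) | ⟨γ', hγ, δ, hδ, rfl⟩
    · refine (support_shuf_subset _ _).trans (Set.union_subset (Set.union_subset ?_ ?_) ?_) <;>
        refine Set.Subset.trans ?_ (Set.subset_union_left.trans Set.subset_union_left)
      · exact setShuf_mono (hα hγ) (hβ hδ)
      · exact setShuf_mono (hα hγ) (Set.singleton_subset_iff.mpr hδ)
      · exact setShuf_mono (Set.singleton_subset_iff.mpr hγ) (hβ hδ)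
    · obtain rfl := Set.mem_singleton_iff.mp hδ
      refine (support_shuf_subset _ _).trans (Set.union_subset (Set.union_subset ?_ ?_) ?_)
      · exact (setShuf_mono (hα hγ) Set.Subset.rfl).trans
          (Set.subset_union_left.trans Set.subset_union_left)
      · exact (setShuf_mono (hα hγ) Set.Subset.rfl).trans
          (Set.subset_union_right.trans Set.subset_union_left)
      · exact (setShuf_mono (Set.singleton_subset_iff.mpr hγ) Set.Subset.rfl).trans
          (Set.subset_union_left.trans Set.subset_union_left)
    · obtain rfl := Set.mem_singleton_iff.mp hγ
      refine (support_shuf_subset _ _).trans (Set.union_subset (Set.union_subset ?_ ?_) ?_)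
      · exact (setShuf_mono Set.Subset.rfl (hβ hδ)).trans
          (Set.subset_union_left.trans Set.subset_union_left)
      · exact (setShuf_mono Set.Subset.rfl (Set.singleton_subset_iff.mpr hδ)).trans
          (Set.subset_union_left.trans Set.subset_union_left)
      · exact (setShuf_mono Set.Subset.rfl (hβ hδ)).trans Set.subset_union_right
  | star α hα =>
    obtain ⟨γ', h', rfl⟩ := h
    exact (support_cat_subset _ _).trans
      (Set.union_subset (setCat_mono (hα h') _) Set.Subset.rfl)

theorem pderivs_subset (α : ShuffleExpr A) : α.pderivs ⊆ insert α α.support := by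
  refine Set.iUnion_subset fun x => ?_
  induction x using List.reverseRecOn with
  | nil => exact Set.singleton_subset_iff.mpr (Set.mem_insert _ _)
  | append_singleton x a ih =>
    simp only [pderivWord, List.foldl_append, List.foldl_cons, List.foldl_nil]
    refine Set.iUnion₂_subset fun γ hγ => ?_
    refine ((pderiv_subset_support a γ).trans ?_).trans (Set.subset_insert _ _)
    rcases ih hγ with rfl | h
    · exact Set.Subset.rfl
    · exact support_subset_of_mem_support h

theorem finite_pderivs (α : ShuffleExpr A) : α.pderivs.Finite :=
  (α.finite_support.insert α).subset α.pderivs_subset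

theorem numStates_pdAutomaton_le (α : ShuffleExpr A) :
    numStates α.pdAutomaton ≤ α.support.ncard + 1 :=
  (Set.ncard_le_ncard α.pderivs_subset (α.finite_support.insert α)).trans (Set.ncard_insert_le _ _)

/-! ### Sums over the expressions of a given size -/

theorem mem_ofSize {k n : ℕ} {α : ShuffleExpr (Fin k)} : α ∈ ofSize k n ↔ α.size = n := by
  simp [ofSize]

theorem size_pos (α : ShuffleExpr A) : 0 < α.size := by
  cases α <;> simp [size]

theorem size_eq_one_iff {α : ShuffleExpr A} : α.size = 1 ↔ α = eps ∨ ∃ a, α = letter a := by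
  cases α with
  | plus α β => simpa [size] using fun h => absurd h (size_pos α).ne'
  | concat α β => simpa [size] using fun h => absurd h (size_pos α).ne'
  | shuffle α β => simpa [size] using fun h => absurd h (size_pos α).ne'
  | star α => simpa [size] using (size_pos α).ne'
  | _ => simp [size]

theorem ofSize_zero (k : ℕ) : ofSize k 0 = ∅ :=
  Finset.eq_empty_of_forall_notMem fun α h => (size_pos α).ne' (mem_ofSize.mp h)

theorem sum_ofSize_one (k : ℕ) (f : ShuffleExpr (Fin k) → ℝ) :
    ∑ α ∈ ofSize k 1, f α = f eps + ∑ a, f (letter a) := by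
  classical
  have h : ofSize k 1 = insert eps (Finset.univ.image letter) := by
    ext α
    rw [mem_ofSize, size_eq_one_iff]
    simp [eq_comm]
  rw [h, Finset.sum_insert (by simp), Finset.sum_image fun a _ b _ h => letter.inj h]

/-- The decomposition of a compound expression at its root. -/
theorem sum_ofSize_add_two (k n : ℕ) (f : ShuffleExpr (Fin k) → ℝ) :
    ∑ α ∈ ofSize k (n + 2), f α = ∑ α ∈ ofSize k (n + 1), f (star α) +
      ∑ p ∈ antidiagonal (n + 1), ∑ α ∈ ofSize k p.1, ∑ β ∈ ofSize k p.2,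
        (f (plus α β) + f (concat α β) + f (shuffle α β)) := by
  classical
  set B := (antidiagonal (n + 1)).biUnion fun p => ofSize k p.1 ×ˢ ofSize k p.2 with hB
  have mem_B : ∀ q : ShuffleExpr (Fin k) × ShuffleExpr (Fin k),
      q ∈ B ↔ q.1.size + q.2.size = n + 1 := by
    intro q
    simp only [hB, Finset.mem_biUnion, Finset.HasAntidiagonal.mem_antidiagonal,
      Finset.mem_product, mem_ofSize]
    exact ⟨fun ⟨p, hp, h₁, h₂⟩ => by omega, fun h => ⟨(_, _), h, rfl, rfl⟩⟩
  have sum_B : ∀ g : ShuffleExpr (Fin k) → ShuffleExpr (Fin k) → ℝ,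
      ∑ q ∈ B, g q.1 q.2 = ∑ p ∈ antidiagonal (n + 1),
        ∑ α ∈ ofSize k p.1, ∑ β ∈ ofSize k p.2, g α β := by
    intro g
    rw [hB, Finset.sum_biUnion]
    · exact Finset.sum_congr rfl fun p _ => Finset.sum_product _ _ _
    · intro p _ p' _ hpp
      refine Finset.disjoint_left.mpr fun q h h' => hpp ?_
      simp only [Finset.mem_product, mem_ofSize] at h h'
      exact Prod.ext (h.1.symm.trans h'.1) (h.2.symm.trans h'.2)
  have h : ofSize k (n + 2) = (ofSize k (n + 1)).image star ∪ (B.image (fun q => plus q.1 q.2) ∪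
      (B.image (fun q => concat q.1 q.2) ∪ B.image (fun q => shuffle q.1 q.2))) := by
    ext α
    rw [mem_ofSize]
    cases α with
    | eps => simp [size]
    | letter a => simp [size]
    | plus α β => simp [size, mem_B]
    | concat α β => simp [size, mem_B]
    | shuffle α β => simp [size, mem_B]
    | star α => simp [size, mem_ofSize]
  rw [h, Finset.sum_union, Finset.sum_union, Finset.sum_union,
    Finset.sum_image (fun _ _ _ _ h => star.inj h),
    Finset.sum_image (fun _ _ _ _ h => Prod.ext (plus.inj h).1 (plus.inj h).2),
    Finset.sum_image (fun _ _ _ _ h => Prod.ext (concat.inj h).1 (concat.inj h).2),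
    Finset.sum_image (fun _ _ _ _ h => Prod.ext (shuffle.inj h).1 (shuffle.inj h).2),
    ← Finset.sum_add_distrib, ← Finset.sum_add_distrib]
  · simp only [← add_assoc]
    rw [sum_B fun α β => f (plus α β) + f (concat α β) + f (shuffle α β)]
  all_goals
    refine Finset.disjoint_left.mpr fun α h h' => ?_
    simp only [Finset.mem_union, Finset.mem_image] at h h'
    aesop

/-! ### Motzkin polynomials -/

open Polynomial in
/-- The polynomial whose coefficient at `X ^ l` is the number of unary-binary trees with `n`
nodes, `l` of them leaves. A tree with `b` binary nodes has `b + 1` leaves, and erasing its unary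
nodes leaves one of `catalan b` shapes with `2 * b + 1` nodes. In preorder the last node is a leaf;
the other `n - 1` nodes comprise the remaining `2 * b` nodes of the shape, in any position, and the
unary nodes. -/
noncomputable def motzkin : ℕ → ℝ[X]
  | 0 => 0
  | n + 1 => ∑ b ∈ Finset.range (n + 1), monomial (b + 1) ((n.choose (2 * b) : ℝ) * catalan b)

theorem motzkin_coeff_zero (n : ℕ) : (motzkin n).coeff 0 = 0 := by
  cases n with
  | zero => simp [motzkin]
  | succ n => simp [motzkin, Polynomial.coeff_monomial]

theorem motzkin_succ_coeff_succ (n b : ℕ) :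
    (motzkin (n + 1)).coeff (b + 1) = (n.choose (2 * b) : ℝ) * catalan b := by
  simp only [motzkin, Polynomial.finsetSum_coeff, Polynomial.coeff_monomial, add_left_inj,
    Finset.sum_ite_eq', Finset.mem_range]
  split_ifs with h
  · rfl
  · rw [Nat.choose_eq_zero_of_lt (by omega)]
    simp

theorem sum_antidiagonal_choose_mul_choose (n p q : ℕ) :
    ∑ ij ∈ antidiagonal n, ij.1.choose p * ij.2.choose q = (n + 1).choose (p + q + 1) := by
  induction n generalizing p q with
  | zero => cases p <;> cases q <;> simp [Nat.choose_eq_zero_of_lt]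
  | succ n ih =>
    rw [Finset.Nat.sum_antidiagonal_succ]
    cases p with
    | zero =>
      have := ih 0 q
      simp only [Nat.choose_zero_right, one_mul, zero_add] at this ⊢
      rw [this, ← Nat.choose_succ_succ]
    | succ p =>
      simp only [Nat.choose_zero_succ, zero_mul, zero_add, Nat.choose_succ_succ _ p, add_mul,
        Finset.sum_add_distrib, ih]
      rw [show p + 1 + q + 1 = (p + q + 1) + 1 by ring, Nat.choose_succ_succ (n + 1)]

theorem sum_antidiagonal_add_two {M : Type*} [AddCommMonoid M] (n : ℕ) (f : ℕ × ℕ → M)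
    (h₁ : ∀ j, f (0, j) = 0) (h₂ : ∀ i, f (i, 0) = 0) :
    ∑ p ∈ antidiagonal (n + 2), f p = ∑ p ∈ antidiagonal n, f (p.1 + 1, p.2 + 1) := by
  rw [Finset.Nat.sum_antidiagonal_succ, Finset.Nat.sum_antidiagonal_succ', h₁, h₂, zero_add,
    zero_add]

/-- The decomposition of a unary-binary tree at its root. -/
theorem motzkin_add_two (n : ℕ) :
    motzkin (n + 2) = motzkin (n + 1) +
      ∑ p ∈ antidiagonal (n + 1), motzkin p.1 * motzkin p.2 := by
  cases n with
  | zero =>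
    ext d
    cases d with
    | zero => simp [motzkin, Finset.Nat.antidiagonal_succ]
    | succ b =>
      rw [Polynomial.coeff_add, motzkin_succ_coeff_succ, motzkin_succ_coeff_succ]
      rcases b with _ | b
      · simp [motzkin, Finset.Nat.antidiagonal_succ]
      · rw [Nat.choose_eq_zero_of_lt (by omega), Nat.choose_eq_zero_of_lt (by omega)]
        simp [motzkin, Finset.Nat.antidiagonal_succ]
  | succ n =>
    rw [sum_antidiagonal_add_two _ _ (fun j => by simp [motzkin]) (fun j => by simp [motzkin])]
    ext d
    rw [Polynomial.coeff_add, Polynomial.finsetSum_coeff]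
    rcases d with _ | _ | b
    · simp [motzkin_coeff_zero, Polynomial.mul_coeff_zero]
    · simp [motzkin_succ_coeff_succ, motzkin_coeff_zero, Polynomial.coeff_mul,
        Finset.Nat.antidiagonal_succ]
    · have h : ∀ p ∈ antidiagonal n,
          (motzkin (p.1 + 1) * motzkin (p.2 + 1)).coeff (b + 2) =
            ∑ q ∈ antidiagonal b, ((p.1.choose (2 * q.1) * p.2.choose (2 * q.2) : ℕ) : ℝ) *
              (catalan q.1 * catalan q.2 : ℕ) := by
        intro p _
        rw [Polynomial.coeff_mul, sum_antidiagonal_add_two _ _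
          (fun j => by simp [motzkin_coeff_zero]) (fun j => by simp [motzkin_coeff_zero])]
        refine Finset.sum_congr rfl fun q _ => ?_
        simp only [motzkin_succ_coeff_succ]
        push_cast
        ring
      rw [show b + 1 + 1 = b + 2 from rfl, Finset.sum_congr rfl h, Finset.sum_comm]
      have h' : ∀ q ∈ antidiagonal b,
          ∑ p ∈ antidiagonal n, ((p.1.choose (2 * q.1) * p.2.choose (2 * q.2) : ℕ) : ℝ) *
              (catalan q.1 * catalan q.2 : ℕ) =
            ((n + 1).choose (2 * b + 1) : ℝ) * (catalan q.1 * catalan q.2 : ℕ) := by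
        intro q hq
        rw [← Finset.sum_mul, ← Nat.cast_sum, sum_antidiagonal_choose_mul_choose,
          ← mul_add, Finset.HasAntidiagonal.mem_antidiagonal.mp hq]
      rw [Finset.sum_congr rfl h', ← Finset.mul_sum, ← Nat.cast_sum, ← catalan_succ',
        motzkin_succ_coeff_succ, motzkin_succ_coeff_succ, ← add_mul, ← Nat.cast_add,
        show 2 * (b + 1) = (2 * b + 1) + 1 by ring, Nat.choose_succ_succ (n + 1),
        add_comm ((n + 1).choose (2 * b + 1))]

theorem motzkin_zero : motzkin 0 = 0 := rfl

theorem motzkin_one : motzkin 1 = Polynomial.X := by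
  simp [motzkin, Polynomial.X]

theorem eval_motzkin_add_two (n : ℕ) (t : ℝ) :
    (motzkin (n + 2)).eval t = (motzkin (n + 1)).eval t +
      ∑ p ∈ antidiagonal (n + 1), (motzkin p.1).eval t * (motzkin p.2).eval t := by
  simp only [motzkin_add_two, Polynomial.eval_add, Polynomial.eval_finsetSum, Polynomial.eval_mul]

/-! ### The averages in terms of Motzkin polynomials -/

/-- A sequence of sums over all expressions that satisfies the recurrence of the Motzkin
polynomials is given by them. -/
theorem eq_eval_motzkin {V : ℕ → ℝ} {t : ℝ} (h₀ : V 0 = 0) (h₁ : V 1 = t)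
    (h₂ : ∀ n, V (n + 2) = V (n + 1) + ∑ p ∈ antidiagonal (n + 1), V p.1 * V p.2) (n : ℕ) :
    V n = (motzkin n).eval t := by
  induction n using Nat.strong_induction_on with
  | _ n ih =>
    rcases n with _ | _ | n
    · simp [h₀, motzkin_zero]
    · simp [h₁, motzkin_one]
    · rw [h₂, eval_motzkin_add_two, ih _ (by omega)]
      congr 1
      refine Finset.sum_congr rfl fun p hp => ?_
      have := Finset.HasAntidiagonal.mem_antidiagonal.mp hp
      by_cases hp₁ : p.1 = 0
      · rw [hp₁, h₀, motzkin_zero]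
        simp
      by_cases hp₂ : p.2 = 0
      · rw [hp₂, h₀, motzkin_zero]
        simp
      rw [ih _ (by omega), ih _ (by omega)]

/-- The convolution of two sums over expressions. -/
theorem sum_sum_mul (k : ℕ) (p : ℕ × ℕ) (f g : ShuffleExpr (Fin k) → ℝ) :
    (∑ α ∈ ofSize k p.1, f α) * ∑ β ∈ ofSize k p.2, g β =
      ∑ α ∈ ofSize k p.1, ∑ β ∈ ofSize k p.2, f α * g β :=
  Finset.sum_mul_sum _ _ _ _

theorem three_mul_card_ofSize (k n : ℕ) :
    3 * ((ofSize k n).card : ℝ) = (motzkin n).eval (3 * ((k : ℝ) + 1)) := by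
  have key := eq_eval_motzkin (V := fun n => ∑ _α ∈ ofSize k n, (3 : ℝ))
    (t := 3 * ((k : ℝ) + 1)) (by simp [ofSize_zero]) ?_ ?_ n
  · rw [← key]
    simp [mul_comm]
  · rw [sum_ofSize_one]
    simp only [Finset.sum_const, Finset.card_univ, Fintype.card_fin, nsmul_eq_mul]
    ring
  · intro n
    rw [sum_ofSize_add_two]
    congr 1
    refine Finset.sum_congr rfl fun p _ => ?_
    rw [sum_sum_mul]
    norm_num

/-- With `3` added to `p(α)`, the three binary operations together act as a product:
`(p + q) + (p + q) + (p q + p + q) + 9 = (p + 3) (q + 3)`. -/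
theorem sum_supportBound_add_three (k n : ℕ) :
    ∑ α ∈ ofSize k n, ((α.supportBound : ℝ) + 3) =
      (motzkin n).eval ((k : ℝ) + 3 * ((k : ℝ) + 1)) := by
  refine eq_eval_motzkin (V := fun n => ∑ α ∈ ofSize k n, ((α.supportBound : ℝ) + 3))
    (by simp [ofSize_zero]) ?_ ?_ n
  · simp only [sum_ofSize_one, supportBound, Finset.sum_const, Finset.card_univ, Fintype.card_fin,
      nsmul_eq_mul]
    push_cast
    ring
  · intro n
    simp only [sum_ofSize_add_two]
    congr 1
    refine Finset.sum_congr rfl fun p _ => ?_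
    rw [sum_sum_mul]
    refine Finset.sum_congr rfl fun α _ => Finset.sum_congr rfl fun β _ => ?_
    simp only [supportBound]
    push_cast
    ring

/-- Marking a letter is differentiation with respect to the number of leaf labels. -/
theorem sum_letters (k n : ℕ) :
    ∑ α ∈ ofSize k n, (α.letters : ℝ) =
      k * (Polynomial.derivative (motzkin n)).eval (3 * ((k : ℝ) + 1)) := by
  induction n using Nat.strong_induction_on with
  | _ n ih =>
    rcases n with _ | _ | n
    · simp [ofSize_zero, motzkin_zero]
    · simp [sum_ofSize_one, letters, motzkin_one]
    · rw [sum_ofSize_add_two, motzkin_add_two]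
      simp only [letters, Polynomial.derivative_add, Polynomial.derivative_sum,
        Polynomial.derivative_mul, Polynomial.eval_add, Polynomial.eval_finsetSum,
        Polynomial.eval_mul, ← three_mul_card_ofSize]
      rw [ih _ (by omega), mul_add (k : ℝ), Finset.mul_sum]
      congr 1
      refine Finset.sum_congr rfl fun p hp => ?_
      have := Finset.HasAntidiagonal.mem_antidiagonal.mp hp
      by_cases hp₁ : p.1 = 0
      · simp [hp₁, ofSize_zero, motzkin_zero]
      by_cases hp₂ : p.2 = 0
      · simp [hp₂, ofSize_zero, motzkin_zero]
      have h₁ := ih p.1 (by omega)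
      have h₂ := ih p.2 (by omega)
      have : ∀ α ∈ ofSize k p.1, ∑ β ∈ ofSize k p.2,
          (((α.letters + β.letters : ℕ) : ℝ) + ((α.letters + β.letters : ℕ) : ℝ) +
            ((α.letters + β.letters : ℕ) : ℝ)) =
          3 * (((ofSize k p.2).card : ℝ) * α.letters + ∑ β ∈ ofSize k p.2, (β.letters : ℝ)) := by
        intro α _
        rw [← nsmul_eq_mul, ← Finset.sum_const, ← Finset.sum_add_distrib, Finset.mul_sum]
        refine Finset.sum_congr rfl fun β _ => ?_
        push_cast
        ring
      rw [Finset.sum_congr rfl this, ← Finset.mul_sum, Finset.sum_add_distrib, ← Finset.mul_sum,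
        Finset.sum_const, nsmul_eq_mul, h₁, h₂]
      ring

/-! ### Estimates for Motzkin polynomials -/

/-- The term of degree `b + 1` of `motzkin (n + 1)` at `t`: the weight of the trees with `b` binary
and `n - 2 * b` unary nodes. -/
noncomputable def motzkinTerm (t : ℝ) (n b : ℕ) : ℝ :=
  (n.choose (2 * b) : ℝ) * catalan b * t ^ (b + 1)

theorem motzkinTerm_nonneg {t : ℝ} (ht : 0 ≤ t) (n b : ℕ) : 0 ≤ motzkinTerm t n b := by
  unfold motzkinTerm
  positivity

theorem motzkinTerm_eq_zero {t : ℝ} {n b : ℕ} (h : n < 2 * b) : motzkinTerm t n b = 0 := by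
  simp [motzkinTerm, Nat.choose_eq_zero_of_lt h]

theorem eval_motzkin_succ (t : ℝ) (n : ℕ) :
    (motzkin (n + 1)).eval t = ∑ b ∈ Finset.range (n + 1), motzkinTerm t n b := by
  simp [motzkin, Polynomial.eval_finsetSum, motzkinTerm]

theorem mul_eval_derivative_motzkin_succ (t : ℝ) (n : ℕ) :
    t * (Polynomial.derivative (motzkin (n + 1))).eval t =
      ∑ b ∈ Finset.range (n + 1), ((b : ℝ) + 1) * motzkinTerm t n b := by
  simp only [motzkin, Polynomial.derivative_sum, Polynomial.eval_finsetSum,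
    Polynomial.derivative_monomial, Polynomial.eval_monomial, motzkinTerm, Finset.mul_sum]
  refine Finset.sum_congr rfl fun b _ => ?_
  simp only [Nat.add_sub_cancel]
  push_cast
  ring

theorem motzkinTerm_le_eval {t : ℝ} (ht : 0 ≤ t) (n b : ℕ) :
    motzkinTerm t n b ≤ (motzkin (n + 1)).eval t := by
  have h₀ : ∀ b ∈ Finset.range (n + 1), 0 ≤ motzkinTerm t n b := fun b _ =>
    motzkinTerm_nonneg ht n b
  rw [eval_motzkin_succ]
  by_cases h : b < n + 1
  · exact Finset.single_le_sum h₀ (Finset.mem_range.mpr h)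
  · rw [motzkinTerm_eq_zero (by omega)]
    exact Finset.sum_nonneg h₀

theorem eval_motzkin_succ_pos {t : ℝ} (ht : 0 < t) (n : ℕ) : 0 < (motzkin (n + 1)).eval t := by
  refine lt_of_lt_of_le ?_ (motzkinTerm_le_eval ht.le n 0)
  simpa [motzkinTerm] using ht

theorem catalan_le_succ (b : ℕ) : catalan b ≤ catalan (b + 1) := by
  rw [catalan_succ']
  refine le_trans ?_ (Finset.single_le_sum (f := fun ij : ℕ × ℕ => catalan ij.1 * catalan ij.2)
    (fun _ _ => Nat.zero_le _)
      (Finset.HasAntidiagonal.mem_antidiagonal.mpr (show (b, 0).1 + (b, 0).2 = b from rfl)))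
  simp

/-- Trading two of the `m = n - 2 * b` unary nodes for a binary node and a leaf of weight `t`
multiplies the total weight by at least `m * (m - 1) * t / n ^ 2`. -/
theorem mul_motzkinTerm_le {t : ℝ} (ht : 0 ≤ t) {n b : ℕ} (h : 2 * b ≤ n) :
    ((n : ℝ) - 2 * b) * ((n : ℝ) - 2 * b - 1) * t * motzkinTerm t n b ≤
      (n : ℝ) ^ 2 * motzkinTerm t n (b + 1) := by
  have h₁ : ((n.choose (2 * b + 1) : ℝ)) * (2 * b + 1) = n.choose (2 * b) * ((n : ℝ) - 2 * b) := by
    have := Nat.choose_succ_right_eq n (2 * b)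
    have h' : ((n - 2 * b : ℕ) : ℝ) = (n : ℝ) - 2 * b := by
      rw [Nat.cast_sub h]
      push_cast
      ring
    rw [← h']
    exact_mod_cast this
  have h₂ : ((n.choose (2 * b + 2) : ℝ)) * (2 * b + 2) =
      n.choose (2 * b + 1) * ((n : ℝ) - 2 * b - 1) := by
    rcases h.eq_or_lt with rfl | h
    · simp [Nat.choose_eq_zero_of_lt]
    have := Nat.choose_succ_right_eq n (2 * b + 1)
    have h' : ((n - (2 * b + 1) : ℕ) : ℝ) = (n : ℝ) - 2 * b - 1 := by
      rw [Nat.cast_sub (by omega)]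
      push_cast
      ring
    rw [← h', show (2 * (b : ℝ) + 2) = ((2 * b + 1 + 1 : ℕ) : ℝ) by push_cast; ring]
    exact_mod_cast this
  have h₃ : ((n : ℝ) - 2 * b) * ((n : ℝ) - 2 * b - 1) * n.choose (2 * b) =
      (2 * b + 1) * (2 * b + 2) * n.choose (2 * b + 2) := by
    linear_combination (-((n : ℝ) - 2 * b - 1)) * h₁ - (2 * (b : ℝ) + 1) * h₂
  have h₄ : (2 * (b : ℝ) + 1) * (2 * b + 2) * n.choose (2 * b + 2) ≤
      (n : ℝ) ^ 2 * n.choose (2 * b + 2) := by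
    by_cases hn : 2 * b + 2 ≤ n
    · have : (2 * (b : ℝ) + 2) ≤ n := by exact_mod_cast hn
      have hb : (0 : ℝ) ≤ b := b.cast_nonneg
      refine mul_le_mul_of_nonneg_right ?_ (Nat.cast_nonneg _)
      nlinarith
    · simp [Nat.choose_eq_zero_of_lt (lt_of_not_ge hn)]
  have h₅ : (catalan b : ℝ) ≤ catalan (b + 1) := by exact_mod_cast catalan_le_succ b
  calc ((n : ℝ) - 2 * b) * ((n : ℝ) - 2 * b - 1) * t * motzkinTerm t n b
      = ((n : ℝ) - 2 * b) * ((n : ℝ) - 2 * b - 1) * n.choose (2 * b) *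
          (catalan b * t ^ (b + 2)) := by
        unfold motzkinTerm
        ring
    _ ≤ (n : ℝ) ^ 2 * n.choose (2 * b + 2) * (catalan (b + 1) * t ^ (b + 2)) := by
        rw [h₃]
        gcongr
    _ = (n : ℝ) ^ 2 * motzkinTerm t n (b + 1) := by
        unfold motzkinTerm
        rw [show 2 * (b + 1) = 2 * b + 2 by ring]
        ring

theorem sum_motzkinTerm_succ_le {t : ℝ} (ht : 0 ≤ t) (n : ℕ) :
    ∑ b ∈ Finset.range (n + 1), motzkinTerm t n (b + 1) ≤ (motzkin (n + 1)).eval t := by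
  have h := Finset.sum_range_succ' (motzkinTerm t n) (n + 1)
  rw [Finset.sum_range_succ, motzkinTerm_eq_zero (b := n + 1) (by omega), add_zero,
    ← eval_motzkin_succ] at h
  linarith [motzkinTerm_nonneg ht n 0]

/-- The mean number of unary nodes of a tree with `n + 1` nodes is at most `1 + 2 * n / √t`. -/
theorem sum_unary_mul_motzkinTerm_le {t : ℝ} (ht : 0 < t) (n : ℕ) :
    ∑ b ∈ Finset.range (n + 1), ((n : ℝ) - 2 * b) * motzkinTerm t n b ≤
      (1 + 2 * n / √t) * (motzkin (n + 1)).eval t := by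
  rcases n.eq_zero_or_pos with rfl | hn
  · simp [(eval_motzkin_succ_pos ht 0).le]
  have hn' : (0 : ℝ) < n := by exact_mod_cast hn
  set s := √t
  have hs : 0 < s := Real.sqrt_pos.mpr ht
  have hst : s * s = t := Real.mul_self_sqrt ht.le
  have key : ∀ b ∈ Finset.range (n + 1), ((n : ℝ) - 2 * b) * motzkinTerm t n b ≤
      (1 + n / s) * motzkinTerm t n b + n / s * motzkinTerm t n (b + 1) := by
    intro b _
    by_cases hb : 2 * b ≤ n
    · have h₁ := mul_motzkinTerm_le ht.le hb
      have hm : (0 : ℝ) ≤ (n : ℝ) - 2 * b := by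
        have : (2 * (b : ℝ)) ≤ n := by exact_mod_cast hb
        linarith
      set m := (n : ℝ) - 2 * b
      have h₀ := motzkinTerm_nonneg ht.le n b
      have h₀' := motzkinTerm_nonneg ht.le n (b + 1)
      -- If `m - 1` exceeds `n / s`, the quadratic bound takes over.
      have h₂ : m ≤ 1 + n / s + m * (m - 1) * (s / n) := by
        have e : n / s * (s / n) = 1 := by field_simp
        rcases le_total m (1 + n / s) with h | h
        · rcases le_total 1 m with h1 | h1
          · have : 0 ≤ m * (m - 1) * (s / n) := by
              have : 0 ≤ m - 1 := by linarith
              positivity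
            linarith
          · have hm' : m = 0 ∨ m = 1 := by
              have : n - 2 * b = 0 ∨ n - 2 * b = 1 := by
                have : ((n - 2 * b : ℕ) : ℝ) ≤ 1 := by
                  rw [Nat.cast_sub hb]
                  push_cast
                  exact h1
                have : n - 2 * b ≤ 1 := by exact_mod_cast this
                omega
              have hcast : m = ((n - 2 * b : ℕ) : ℝ) := by
                rw [Nat.cast_sub hb]
                push_cast
                rfl
              rw [hcast]
              exact_mod_cast this
            have : 0 ≤ n / s := by positivity
            rcases hm' with h | h <;> rw [h] <;> norm_num <;> linarith
        · have h3 : 1 ≤ (m - 1) * (s / n) := by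
            rw [← e]
            exact mul_le_mul_of_nonneg_right (by linarith) (by positivity)
          have : 0 ≤ n / s := by positivity
          nlinarith
      have h₃ : m * (m - 1) * (s / n) * motzkinTerm t n b ≤ n / s * motzkinTerm t n (b + 1) := by
        have := mul_le_mul_of_nonneg_left h₁ (show 0 ≤ 1 / (s * n) by positivity)
        calc m * (m - 1) * (s / n) * motzkinTerm t n b
            = 1 / (s * n) * (m * (m - 1) * t * motzkinTerm t n b) := by
              rw [← hst]
              field_simp
          _ ≤ _ := this
          _ = n / s * motzkinTerm t n (b + 1) := by field_simp
      calc m * motzkinTerm t n b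
          ≤ (1 + n / s + m * (m - 1) * (s / n)) * motzkinTerm t n b := by gcongr
        _ ≤ _ := by linarith
    · have := motzkinTerm_nonneg ht.le n (b + 1)
      rw [motzkinTerm_eq_zero (by omega)]
      simp only [mul_zero, zero_add]
      positivity
  refine (Finset.sum_le_sum key).trans ?_
  rw [Finset.sum_add_distrib, ← Finset.mul_sum, ← Finset.mul_sum, ← eval_motzkin_succ]
  have := mul_le_mul_of_nonneg_left (sum_motzkinTerm_succ_le ht.le n)
    (show 0 ≤ n / s by positivity)
  calc _ ≤ (1 + n / s) * (motzkin (n + 1)).eval t + n / s * (motzkin (n + 1)).eval t := by gcongr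
    _ = _ := by ring

/-- The mean number of leaves of a tree with `n + 1` nodes, each leaf having weight `t`. -/
noncomputable def meanLeaves (t : ℝ) (n : ℕ) : ℝ :=
  t * (Polynomial.derivative (motzkin (n + 1))).eval t / (motzkin (n + 1)).eval t

theorem sum_two_mul_succ_mul_motzkinTerm (t : ℝ) (n : ℕ) :
    2 * (t * (Polynomial.derivative (motzkin (n + 1))).eval t) =
      (n + 2) * (motzkin (n + 1)).eval t -
        ∑ b ∈ Finset.range (n + 1), ((n : ℝ) - 2 * b) * motzkinTerm t n b := by
  rw [mul_eval_derivative_motzkin_succ, eval_motzkin_succ, Finset.mul_sum, Finset.mul_sum,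
    ← Finset.sum_sub_distrib]
  refine Finset.sum_congr rfl fun b _ => ?_
  ring

theorem le_meanLeaves {t : ℝ} (ht : 0 < t) (n : ℕ) :
    ((n : ℝ) + 1 - 2 * n / √t) / 2 ≤ meanLeaves t n := by
  have hM := eval_motzkin_succ_pos ht n
  have h₁ := sum_two_mul_succ_mul_motzkinTerm t n
  have h₂ := sum_unary_mul_motzkinTerm_le ht n
  rw [meanLeaves, le_div_iff₀ hM]
  linarith

theorem meanLeaves_le {t : ℝ} (ht : 0 < t) (n : ℕ) : meanLeaves t n ≤ ((n : ℝ) + 2) / 2 := by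
  have hM := eval_motzkin_succ_pos ht n
  have h₁ := sum_two_mul_succ_mul_motzkinTerm t n
  have h₂ : 0 ≤ ∑ b ∈ Finset.range (n + 1), ((n : ℝ) - 2 * b) * motzkinTerm t n b := by
    refine Finset.sum_nonneg fun b _ => ?_
    by_cases hb : 2 * b ≤ n
    · have : (2 * (b : ℝ)) ≤ n := by exact_mod_cast hb
      exact mul_nonneg (by linarith) (motzkinTerm_nonneg ht.le n b)
    · rw [motzkinTerm_eq_zero (by omega), mul_zero]
  rw [meanLeaves, div_le_iff₀ hM]
  linarith

theorem motzkinTerm_mul (t τ : ℝ) (n b : ℕ) :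
    motzkinTerm (τ * t) n b = τ ^ (b + 1) * motzkinTerm t n b := by
  unfold motzkinTerm
  rw [mul_pow]
  ring

theorem eval_motzkin_mul_le {t τ : ℝ} (ht : 0 < t) (hτ : 1 ≤ τ) (n : ℕ) :
    (motzkin (n + 1)).eval (τ * t) ≤ τ ^ (((n : ℝ) + 2) / 2) * (motzkin (n + 1)).eval t := by
  rw [eval_motzkin_succ, eval_motzkin_succ, Finset.mul_sum]
  refine Finset.sum_le_sum fun b _ => ?_
  rw [motzkinTerm_mul]
  by_cases hb : 2 * b ≤ n
  · refine mul_le_mul_of_nonneg_right ?_ (motzkinTerm_nonneg ht.le n b)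
    rw [← Real.rpow_natCast]
    refine Real.rpow_le_rpow_of_exponent_le hτ ?_
    have : (2 * (b : ℝ)) ≤ n := by exact_mod_cast hb
    push_cast
    linarith
  · rw [motzkinTerm_eq_zero (by omega), mul_zero, mul_zero]

/-- Jensen's inequality for the distribution of the number of leaves. -/
theorem rpow_meanLeaves_mul_le {t τ : ℝ} (ht : 0 < t) (hτ : 0 < τ) (n : ℕ) :
    τ ^ meanLeaves t n * (motzkin (n + 1)).eval t ≤ (motzkin (n + 1)).eval (τ * t) := by
  have hM := eval_motzkin_succ_pos ht n
  set E := meanLeaves t n with hE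
  have hE' : E * (motzkin (n + 1)).eval t =
      ∑ b ∈ Finset.range (n + 1), ((b : ℝ) + 1) * motzkinTerm t n b := by
    rw [hE, meanLeaves, div_mul_cancel₀ _ hM.ne', mul_eval_derivative_motzkin_succ]
  -- The tangent line of `l ↦ τ ^ l` at the mean.
  have key : ∀ b : ℕ, τ ^ E * (1 + ((b : ℝ) + 1 - E) * Real.log τ) ≤ τ ^ (b + 1) := by
    intro b
    have h : τ ^ (b + 1) = τ ^ E * Real.exp (((b : ℝ) + 1 - E) * Real.log τ) := by
      rw [← Real.rpow_natCast, Real.rpow_def_of_pos hτ, Real.rpow_def_of_pos hτ, ← Real.exp_add]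
      push_cast
      congr 1
      ring
    rw [h]
    refine mul_le_mul_of_nonneg_left ?_ (Real.rpow_nonneg hτ.le _)
    linarith [Real.add_one_le_exp (((b : ℝ) + 1 - E) * Real.log τ)]
  calc τ ^ E * (motzkin (n + 1)).eval t
      = τ ^ E * ((motzkin (n + 1)).eval t + Real.log τ * (E * (motzkin (n + 1)).eval t -
          E * (motzkin (n + 1)).eval t)) := by ring
    _ = ∑ b ∈ Finset.range (n + 1), τ ^ E * (1 + ((b : ℝ) + 1 - E) * Real.log τ) *
          motzkinTerm t n b := by
        nth_rewrite 1 [hE']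
        rw [eval_motzkin_succ, Finset.mul_sum, ← Finset.sum_sub_distrib, Finset.mul_sum,
          ← Finset.sum_add_distrib, Finset.mul_sum]
        refine Finset.sum_congr rfl fun b _ => ?_
        ring
    _ ≤ ∑ b ∈ Finset.range (n + 1), τ ^ (b + 1) * motzkinTerm t n b :=
        Finset.sum_le_sum fun b _ =>
          mul_le_mul_of_nonneg_right (key b) (motzkinTerm_nonneg ht.le n b)
    _ = (motzkin (n + 1)).eval (τ * t) := by
        rw [eval_motzkin_succ]
        exact Finset.sum_congr rfl fun b _ => (motzkinTerm_mul t τ n b).symm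

/-- An exponential moment bound for the number of unary nodes: when leaves are heavy, the weight of
the trees with more than `δ * n` unary nodes decays geometrically. -/
theorem pow_unary_mul_motzkinTerm_le {t u δ : ℝ} (ht : 0 < t) (hu : 1 ≤ u) (hδ : 0 < δ)
    (h : u ^ 2 ≤ δ ^ 2 * t) (n m b : ℕ) (hm : m + 2 * b = n) :
    u ^ m * motzkinTerm t n b ≤ u ^ (δ * n + 1) * (motzkin (n + 1)).eval t := by
  induction m using Nat.strong_induction_on generalizing b with
  | _ m ih =>
    have hmR : (m : ℝ) = (n : ℝ) - 2 * b := by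
      rw [← hm]
      push_cast
      ring
    by_cases hmδ : (m : ℝ) ≤ δ * n + 1
    · rw [← Real.rpow_natCast]
      exact mul_le_mul (Real.rpow_le_rpow_of_exponent_le hu hmδ) (motzkinTerm_le_eval ht.le n b)
        (motzkinTerm_nonneg ht.le n b) (Real.rpow_nonneg (by linarith) _)
    · push Not at hmδ
      have hm2 : 2 ≤ m := by
        have : (1 : ℝ) < m := lt_of_le_of_lt (by have : 0 ≤ δ * n := by positivity
                                                 linarith) hmδ
        exact_mod_cast this
      obtain ⟨m, rfl⟩ := Nat.exists_eq_add_of_le' hm2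
      have hn : (0 : ℝ) < n := by
        have : 0 < n := by omega
        exact_mod_cast this
      have h₁ := mul_motzkinTerm_le ht.le (n := n) (b := b) (by omega)
      rw [← hmR] at h₁
      have h₀ := motzkinTerm_nonneg ht.le n b
      have h₂ : (δ * n) ^ 2 ≤ ((m + 2 : ℕ) : ℝ) * (((m + 2 : ℕ) : ℝ) - 1) := by
        have : 0 < δ * n := by positivity
        nlinarith
      have h₃ : u ^ 2 * motzkinTerm t n b ≤ motzkinTerm t n (b + 1) := by
        have h₄ : (n : ℝ) ^ 2 * (u ^ 2 * motzkinTerm t n b) ≤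
            (n : ℝ) ^ 2 * motzkinTerm t n (b + 1) := by
          calc (n : ℝ) ^ 2 * (u ^ 2 * motzkinTerm t n b)
              ≤ (n : ℝ) ^ 2 * ((δ ^ 2 * t) * motzkinTerm t n b) := by gcongr
            _ = (δ * n) ^ 2 * t * motzkinTerm t n b := by ring
            _ ≤ ((m + 2 : ℕ) : ℝ) * (((m + 2 : ℕ) : ℝ) - 1) * t * motzkinTerm t n b := by gcongr
            _ ≤ _ := h₁
        exact le_of_mul_le_mul_left h₄ (by positivity)
      calc u ^ (m + 2) * motzkinTerm t n b = u ^ m * (u ^ 2 * motzkinTerm t n b) := by ring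
        _ ≤ u ^ m * motzkinTerm t n (b + 1) := by gcongr
        _ ≤ _ := ih m (by omega) (b + 1) (by omega)

theorem four_pow_le_mul_catalan (b : ℕ) : 4 ^ b ≤ (2 * b + 1) * ((b + 1) * catalan b) := by
  rw [succ_mul_catalan_eq_centralBinom]
  exact Nat.four_pow_le_two_mul_add_one_mul_central_binom b

/-! ### A refined bound on the support -/

/-- The number of leaves, that is, of occurrences of letters and of `ε`. -/
def leaves : ShuffleExpr A → ℕ
  | eps => 1
  | letter _ => 1
  | plus α β => leaves α + leaves β
  | concat α β => leaves α + leaves β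
  | shuffle α β => leaves α + leaves β
  | star α => leaves α

theorem two_mul_leaves_le (α : ShuffleExpr A) : 2 * α.leaves ≤ α.size + 1 := by
  induction α <;> simp only [leaves, size] <;> omega

theorem leaves_pos (α : ShuffleExpr A) : 0 < α.leaves := by
  induction α <;> simp only [leaves] <;> omega

/-- A bound on the cardinality of the support that takes into account that the supports of two
leaves are both contained in `{ε}`, so that their sum is counted once. The value `1` at `ε` is
generous and makes all leaves alike. -/
def refinedBound : ShuffleExpr A → ℕ
  | eps => 1
  | letter _ => 1
  | plus α β => if α.size + β.size = 2 then 1 else refinedBound α + refinedBound β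
  | concat α β => refinedBound α + refinedBound β
  | shuffle α β => refinedBound α * refinedBound β + refinedBound α + refinedBound β
  | star α => refinedBound α

theorem refinedBound_of_size_eq_one {α : ShuffleExpr A} (h : α.size = 1) :
    α.refinedBound = 1 := by
  rcases size_eq_one_iff.mp h with rfl | ⟨a, rfl⟩ <;> rfl

theorem leaves_of_size_eq_one {α : ShuffleExpr A} (h : α.size = 1) : α.leaves = 1 := by
  rcases size_eq_one_iff.mp h with rfl | ⟨a, rfl⟩ <;> rfl

theorem support_subset_of_size_eq_one {α : ShuffleExpr A} (h : α.size = 1) :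
    α.support ⊆ {eps} := by
  rcases size_eq_one_iff.mp h with rfl | ⟨a, rfl⟩
  · exact Set.empty_subset _
  · exact Set.Subset.rfl

theorem ncard_support_le_refinedBound (α : ShuffleExpr A) :
    α.support.ncard ≤ α.refinedBound := by
  induction α with
  | eps => simp [support, refinedBound]
  | letter a => simp [support, refinedBound]
  | plus α β hα hβ =>
    simp only [refinedBound]
    split_ifs with h
    · have := size_pos α
      have := size_pos β
      rw [← Set.ncard_singleton (eps : ShuffleExpr A)]
      exact Set.ncard_le_ncard (Set.union_subset (support_subset_of_size_eq_one (by omega))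
        (support_subset_of_size_eq_one (by omega))) (Set.finite_singleton _)
    · exact (Set.ncard_union_le _ _).trans (add_le_add hα hβ)
  | concat α β hα hβ => exact (ncard_support_concat_le α β).trans (add_le_add hα hβ)
  | shuffle α β hα hβ =>
    refine (ncard_support_shuffle_le α β).trans ?_
    simp only [refinedBound]
    gcongr
  | star α hα => exact (ncard_setCat_le α.finite_support _).trans hα

/-- The sum of `q(α) + 3`, for the refined bound `q`, over the expressions of size `n`, each leaf
having weight `v`. -/
noncomputable def refinedSum (k : ℕ) (v : ℝ) (n : ℕ) : ℝ :=
  ∑ α ∈ ofSize k n, ((α.refinedBound : ℝ) + 3) * v ^ α.leaves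

theorem refinedSum_nonneg {v : ℝ} (hv : 0 ≤ v) (k n : ℕ) : 0 ≤ refinedSum k v n :=
  Finset.sum_nonneg fun _ _ => by positivity

theorem refinedSum_zero (k : ℕ) (v : ℝ) : refinedSum k v 0 = 0 := by
  simp [refinedSum, ofSize_zero]

theorem refinedSum_one (k : ℕ) (v : ℝ) : refinedSum k v 1 = 4 * (((k : ℝ) + 1) * v) := by
  simp only [refinedSum, sum_ofSize_one, refinedBound, leaves, Finset.sum_const, Finset.card_univ,
    Fintype.card_fin, nsmul_eq_mul]
  push_cast
  ring

/-- The recurrence of the refined sums is that of the Motzkin polynomials, except that sums of two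
leaves contribute one less. -/
theorem refinedSum_add_two_le {v : ℝ} (hv : 0 ≤ v) (k n : ℕ) :
    refinedSum k v (n + 2) + (if n = 1 then (((k : ℝ) + 1) * v) ^ 2 else 0) ≤
      refinedSum k v (n + 1) +
        ∑ p ∈ antidiagonal (n + 1), refinedSum k v p.1 * refinedSum k v p.2 := by
  have h₁ : ∑ α ∈ ofSize k (n + 1), (((star α).refinedBound : ℝ) + 3) * v ^ (star α).leaves =
      refinedSum k v (n + 1) := rfl
  rw [refinedSum, sum_ofSize_add_two, h₁, add_assoc]
  refine add_le_add_right ?_ _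
  split_ifs with hn
  · subst hn
    have h₂ : ∀ α ∈ ofSize k 1, ∀ β ∈ ofSize k 1,
        (((plus α β).refinedBound : ℝ) + 3) * v ^ (plus α β).leaves +
          (((concat α β).refinedBound : ℝ) + 3) * v ^ (concat α β).leaves +
          (((shuffle α β).refinedBound : ℝ) + 3) * v ^ (shuffle α β).leaves = 15 * v ^ 2 := by
      intro α hα β hβ
      rw [mem_ofSize] at hα hβ
      simp only [refinedBound, leaves, refinedBound_of_size_eq_one hα,
        refinedBound_of_size_eq_one hβ, leaves_of_size_eq_one hα, leaves_of_size_eq_one hβ, hα, hβ]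
      norm_num
      ring
    have hc : ((ofSize k 1).card : ℝ) = k + 1 := by
      have := three_mul_card_ofSize k 1
      rw [motzkin_one, Polynomial.eval_X] at this
      linarith
    have h₃ := Finset.sum_congr rfl fun α hα => Finset.sum_congr rfl (h₂ α hα)
    rw [sum_antidiagonal_add_two 0 _ (fun j => by simp [ofSize_zero])
      (fun i => by simp [ofSize_zero]), sum_antidiagonal_add_two 0 _
      (fun j => by simp [refinedSum_zero]) (fun i => by simp [refinedSum_zero])]
    simp only [Finset.HasAntidiagonal.antidiagonal_zero, Finset.sum_singleton, zero_add]
    rw [h₃, refinedSum_one]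
    simp only [Finset.sum_const, nsmul_eq_mul, hc]
    apply le_of_eq
    ring
  · rw [add_zero]
    refine Finset.sum_le_sum fun p _ => ?_
    rw [refinedSum, refinedSum, sum_sum_mul]
    refine Finset.sum_le_sum fun α _ => Finset.sum_le_sum fun β _ => ?_
    have h₂ : ((plus α β).refinedBound : ℝ) ≤ α.refinedBound + β.refinedBound := by
      simp only [refinedBound]
      split_ifs with h
      · have := size_pos α
        have := size_pos β
        rw [refinedBound_of_size_eq_one (show α.size = 1 by omega),
          refinedBound_of_size_eq_one (show β.size = 1 by omega)]
        norm_num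
      · push_cast
        rfl
    simp only [leaves]
    calc _ ≤ ((α.refinedBound : ℝ) + β.refinedBound + 3) * v ^ (α.leaves + β.leaves) +
          (((concat α β).refinedBound : ℝ) + 3) * v ^ (α.leaves + β.leaves) +
          (((shuffle α β).refinedBound : ℝ) + 3) * v ^ (α.leaves + β.leaves) := by gcongr
      _ = _ := by
        simp only [refinedBound]
        push_cast
        ring

/-- A sequence whose generating function `Y` is dominated by the solution of
`Y = 4 x - x ^ 2 + ζ Y + Y ^ 2` has bounded partial sums. Since `4 x - x ^ 2 < 1 / 4` at
`x = 10 / 159`, a positive `ζ` such as `1 / 250` is allowed there; the number `159 / 10` takes the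
role of `16`, the reciprocal of the singularity of the solution of `Y = 4 x + Y ^ 2`. -/
theorem sum_range_le_half {a : ℕ → ℝ} (ha : ∀ n, 0 ≤ a n) (h₀ : a 0 = 0) (h₁ : a 1 = 4 * (10 / 159))
    (h₂ : ∀ n, a (n + 2) + (if n = 1 then (10 / 159 : ℝ) ^ 2 else 0) ≤
      1 / 250 * a (n + 1) + ∑ p ∈ antidiagonal (n + 1), a p.1 * a p.2) (N : ℕ) :
    ∑ n ∈ Finset.range N, a n ≤ 1 / 2 := by
  have hconv : ∀ N, ∑ n ∈ Finset.range N, ∑ p ∈ antidiagonal (n + 1), a p.1 * a p.2 ≤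
      (∑ n ∈ Finset.range (N + 1), a n) ^ 2 := by
    intro N
    rw [sq, Finset.sum_mul_sum, ← Finset.sum_product', ← Finset.sum_biUnion]
    · refine Finset.sum_le_sum_of_subset_of_nonneg ?_ fun p _ _ => mul_nonneg (ha _) (ha _)
      intro p hp
      simp only [Finset.mem_biUnion, Finset.mem_range, Finset.HasAntidiagonal.mem_antidiagonal,
        Finset.mem_product] at hp ⊢
      omega
    · intro i _ j _ hij
      refine Finset.disjoint_left.mpr fun p hi hj => hij ?_
      rw [Finset.HasAntidiagonal.mem_antidiagonal] at hi hj
      omega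
  have hstep : ∀ N, ∑ n ∈ Finset.range (N + 2), a n +
      ∑ n ∈ Finset.range N, (if n = 1 then (10 / 159 : ℝ) ^ 2 else 0) ≤
      4 * (10 / 159) + 1 / 250 * ∑ n ∈ Finset.range (N + 1), a n +
        (∑ n ∈ Finset.range (N + 1), a n) ^ 2 := by
    intro N
    have h := Finset.sum_le_sum fun n (_ : n ∈ Finset.range N) => h₂ n
    rw [Finset.sum_add_distrib, Finset.sum_add_distrib, ← Finset.mul_sum] at h
    have e₁ := Finset.sum_range_succ' a N
    have e₂ := Finset.sum_range_succ' a (N + 1)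
    have e₃ := Finset.sum_range_succ' (fun n => a (n + 1)) N
    simp only [zero_add] at e₁ e₂ e₃
    have := hconv N
    linarith
  have h2 : ∑ n ∈ Finset.range 2, a n = 4 * (10 / 159) := by
    simp [Finset.sum_range_succ, h₀, h₁]
  have h3 : a 2 ≤ 1 / 250 * (4 * (10 / 159)) := by
    have := h₂ 0
    simpa [Finset.Nat.antidiagonal_succ, h₀, h₁] using this
  induction N with
  | zero => simp
  | succ N ih =>
    rcases N with _ | _ | _ | N
    · simp [h₀]
    · rw [h2]
      norm_num
    · rw [Finset.sum_range_succ, h2]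
      linarith
    · have h := hstep (N + 2)
      have hnonneg : 0 ≤ ∑ n ∈ Finset.range (N + 2 + 1), a n := Finset.sum_nonneg fun n _ => ha n
      rw [Finset.sum_ite_eq' , if_pos (by simp)] at h
      have hs : (∑ n ∈ Finset.range (N + 2 + 1), a n) ^ 2 ≤ (1 / 2) ^ 2 :=
        pow_le_pow_left₀ hnonneg ih 2
      have ih' : ∑ n ∈ Finset.range (N + 2 + 1), a n ≤ 1 / 2 := ih
      change ∑ n ∈ Finset.range (N + 2 + 2), a n ≤ 1 / 2
      linarith

/-- The bound on the refined sums at the point where `κ ζ ^ 2 = 10 / 159`, with `ζ = 1 / 250`. -/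
theorem refinedSum_mul_pow_le {v : ℝ} (k : ℕ) (hv : ((k : ℝ) + 1) * v = 10 / 159 * 250 ^ 2)
    (n : ℕ) : refinedSum k v n * (1 / 250) ^ (n + 1) ≤ 1 / 2 := by
  have hv₀ : 0 ≤ v := by
    by_contra h
    have : ((k : ℝ) + 1) * v < 0 := mul_neg_of_pos_of_neg (by positivity) (not_le.mp h)
    rw [hv] at this
    norm_num at this
  have ha : ∀ n, 0 ≤ refinedSum k v n * (1 / 250 : ℝ) ^ (n + 1) := fun n =>
    mul_nonneg (refinedSum_nonneg hv₀ k n) (by positivity)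
  refine (Finset.single_le_sum (fun n _ => ha n) (Finset.self_mem_range_succ n)).trans
    (sum_range_le_half ha ?_ ?_ ?_ (n + 1))
  · simp [refinedSum_zero]
  · rw [refinedSum_one, hv]
    norm_num
  · intro n
    have h := mul_le_mul_of_nonneg_right (refinedSum_add_two_le hv₀ k n)
      (show (0 : ℝ) ≤ (1 / 250) ^ (n + 3) by positivity)
    rw [hv, add_mul, add_mul, Finset.sum_mul] at h
    have e : ∀ p ∈ antidiagonal (n + 1),
        refinedSum k v p.1 * refinedSum k v p.2 * (1 / 250 : ℝ) ^ (n + 3) =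
          refinedSum k v p.1 * (1 / 250) ^ (p.1 + 1) *
            (refinedSum k v p.2 * (1 / 250) ^ (p.2 + 1)) := by
      intro p hp
      rw [show n + 3 = (p.1 + 1) + (p.2 + 1) by
        have := Finset.HasAntidiagonal.mem_antidiagonal.mp hp
        omega, pow_add]
      ring
    rw [Finset.sum_congr rfl e] at h
    have e' : (if n = 1 then (10 / 159 * 250 ^ 2 : ℝ) ^ 2 else 0) * (1 / 250) ^ (n + 3) =
        if n = 1 then (10 / 159 : ℝ) ^ 2 else 0 := by
      split_ifs with hn
      · subst hn
        norm_num
      · simp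
    rw [e'] at h
    refine h.trans (le_of_eq ?_)
    ring

/-- Up to a polynomial factor and a factor for the unary nodes, the refined bound grows like
`(53 / 40) ^ b` in the number `b` of binary operations, where `53 / 40 = (159 / 10) / 12` is less
than `4 / 3 = 16 / 12`. -/
theorem sum_refinedBound_add_three_le {δ : ℝ} (hδ : 0 < δ) (k n : ℕ)
    (hk : (250 : ℝ) ^ 2 ≤ δ ^ 2 * (3 * ((k : ℝ) + 1))) :
    ∑ α ∈ ofSize k (n + 1), ((α.refinedBound : ℝ) + 3) ≤
      2 * ((n : ℝ) + 1) ^ 3 * (53 / 40 : ℝ) ^ (((n : ℝ) + 2) / 2) * (250 : ℝ) ^ (δ * n + 1) *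
        (motzkin (n + 1)).eval (3 * ((k : ℝ) + 1)) := by
  have hK : (0 : ℝ) < (k : ℝ) + 1 := by positivity
  set K : ℝ := (k : ℝ) + 1 with hKdef
  set M := (motzkin (n + 1)).eval (3 * K) with hM
  have hM₀ : 0 < M := eval_motzkin_succ_pos (by positivity) n
  set v : ℝ := 10 / 159 * 250 ^ 2 / K with hv
  have hv₀ : 0 < v := by positivity
  have hKv : K * v = 10 / 159 * 250 ^ 2 := by
    rw [hv]
    field_simp
  have hmaps : ∀ α ∈ ofSize k (n + 1), α.leaves - 1 ∈ Finset.range (n / 2 + 1) := by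
    intro α hα
    have h₁ := two_mul_leaves_le α
    have h₂ := leaves_pos α
    rw [mem_ofSize.mp hα] at h₁
    rw [Finset.mem_range]
    omega
  rw [← Finset.sum_fiberwise_of_maps_to hmaps]
  have key : ∀ b ∈ Finset.range (n / 2 + 1),
      ∑ α ∈ ofSize k (n + 1) with α.leaves - 1 = b, ((α.refinedBound : ℝ) + 3) ≤
        2 * ((n : ℝ) + 1) ^ 2 * (53 / 40 : ℝ) ^ (((n : ℝ) + 2) / 2) *
          ((250 : ℝ) ^ (δ * n + 1) * M) := by
    intro b hb
    obtain ⟨m, hm⟩ : ∃ m, m + 2 * b = n := ⟨n - 2 * b, by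
      rw [Finset.mem_range] at hb
      omega⟩
    set F := ∑ α ∈ ofSize k (n + 1) with α.leaves - 1 = b, ((α.refinedBound : ℝ) + 3) with hF
    have h₁ : F * v ^ (b + 1) ≤ refinedSum k v (n + 1) := by
      rw [hF, Finset.sum_mul]
      refine (Finset.sum_le_sum fun α hα => ?_).trans
        (Finset.sum_le_sum_of_subset_of_nonneg (Finset.filter_subset _ _)
          fun α _ _ => by positivity)
      rw [← (Finset.mem_filter.mp hα).2, Nat.sub_add_cancel (leaves_pos α)]
    have h₂ : F * v ^ (b + 1) * (1 / 250) ^ (n + 2) ≤ 1 / 2 :=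
      (mul_le_mul_of_nonneg_right h₁ (by positivity)).trans (refinedSum_mul_pow_le k hKv (n + 1))
    have h₃ : F ≤ 1 / 2 * (250 ^ m * ((53 / 40) ^ (b + 1) * (4 * 4 ^ b * (3 * K) ^ (b + 1)))) := by
      have e : (v ^ (b + 1) * (1 / 250) ^ (n + 2)) *
          (250 ^ m * ((53 / 40) ^ (b + 1) * (4 * 4 ^ b * (3 * K) ^ (b + 1)))) = 1 := by
        calc _ = (250 * (1 / 250 : ℝ)) ^ m *
              ((K * v) * (1 / 250) ^ 2 * (53 / 40) * 4 * 3) ^ (b + 1) := by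
              rw [← hm]
              simp only [mul_pow, pow_add, pow_mul]
              ring
          _ = 1 := by
              rw [hKv]
              norm_num
      set D := 250 ^ m * ((53 / 40) ^ (b + 1) * (4 * 4 ^ b * (3 * K) ^ (b + 1))) with hD
      have hD₀ : 0 ≤ D := by positivity
      calc F = F * (v ^ (b + 1) * (1 / 250) ^ (n + 2) * D) := by rw [e, mul_one]
        _ = F * v ^ (b + 1) * (1 / 250) ^ (n + 2) * D := by ring
        _ ≤ 1 / 2 * D := mul_le_mul_of_nonneg_right h₂ hD₀
    have hbn : 2 * (b : ℝ) ≤ n := by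
      have : 2 * b ≤ n := by omega
      exact_mod_cast this
    have h₄ : (53 / 40 : ℝ) ^ (b + 1) ≤ (53 / 40 : ℝ) ^ (((n : ℝ) + 2) / 2) := by
      rw [← Real.rpow_natCast]
      refine Real.rpow_le_rpow_of_exponent_le (by norm_num) ?_
      push_cast
      linarith
    have h₅ : (4 : ℝ) ^ b * (3 * K) ^ (b + 1) ≤ ((n : ℝ) + 1) ^ 2 * motzkinTerm (3 * K) n b := by
      have c₁ : (4 : ℝ) ^ b ≤ (2 * b + 1) * ((b + 1) * catalan b) := by
        exact_mod_cast four_pow_le_mul_catalan b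
      have c₂ : (1 : ℝ) ≤ n.choose (2 * b) := by
        have : 0 < n.choose (2 * b) := Nat.choose_pos (by omega)
        exact_mod_cast this
      have hb₀ : (0 : ℝ) ≤ b := b.cast_nonneg
      have c₃ : (4 : ℝ) ^ b ≤ ((n : ℝ) + 1) ^ 2 * (n.choose (2 * b) * catalan b) := by
        calc (4 : ℝ) ^ b ≤ (2 * b + 1) * ((b + 1) * catalan b) := c₁
          _ ≤ ((n : ℝ) + 1) * ((n + 1) * (n.choose (2 * b) * catalan b)) := by
            gcongr
            · linarith
            · exact le_mul_of_one_le_left (Nat.cast_nonneg _) c₂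
          _ = _ := by ring
      calc _ ≤ ((n : ℝ) + 1) ^ 2 * (n.choose (2 * b) * catalan b) * (3 * K) ^ (b + 1) := by gcongr
        _ = _ := by
          unfold motzkinTerm
          ring
    have h₆ := pow_unary_mul_motzkinTerm_le (t := 3 * K) (u := 250) (by positivity) (by norm_num)
      hδ hk n m b hm
    calc F ≤ 1 / 2 * (250 ^ m * ((53 / 40) ^ (b + 1) * (4 * 4 ^ b * (3 * K) ^ (b + 1)))) := h₃
      _ = 2 * (53 / 40) ^ (b + 1) * (250 ^ m * (4 ^ b * (3 * K) ^ (b + 1))) := by ring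
      _ ≤ 2 * (53 / 40 : ℝ) ^ (((n : ℝ) + 2) / 2) *
          (250 ^ m * (((n : ℝ) + 1) ^ 2 * motzkinTerm (3 * K) n b)) := by gcongr
      _ = 2 * ((n : ℝ) + 1) ^ 2 * (53 / 40 : ℝ) ^ (((n : ℝ) + 2) / 2) *
          (250 ^ m * motzkinTerm (3 * K) n b) := by ring
      _ ≤ _ := by gcongr
  refine (Finset.sum_le_sum key).trans ?_
  rw [Finset.sum_const, Finset.card_range, nsmul_eq_mul]
  have hc : ((n / 2 + 1 : ℕ) : ℝ) ≤ n + 1 := by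
    have : n / 2 + 1 ≤ n + 1 := by omega
    exact_mod_cast this
  calc _ ≤ ((n : ℝ) + 1) * (2 * ((n : ℝ) + 1) ^ 2 * (53 / 40 : ℝ) ^ (((n : ℝ) + 2) / 2) *
          ((250 : ℝ) ^ (δ * n + 1) * M)) := by gcongr
    _ = _ := by ring

/-! ### Bounds on the averages -/

theorem card_ofSize_eq (k n : ℕ) :
    ((ofSize k n).card : ℝ) = (motzkin n).eval (3 * ((k : ℝ) + 1)) / 3 := by
  rw [← three_mul_card_ofSize]
  ring

theorem avStates_succ_le {δ : ℝ} (hδ : 0 < δ) (k n : ℕ)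
    (hk : (250 : ℝ) ^ 2 ≤ δ ^ 2 * (3 * ((k : ℝ) + 1))) :
    avStates k (n + 1) ≤
      6 * ((n : ℝ) + 1) ^ 3 * (53 / 40 : ℝ) ^ (((n : ℝ) + 2) / 2) * (250 : ℝ) ^ (δ * n + 1) := by
  have hM : 0 < (motzkin (n + 1)).eval (3 * ((k : ℝ) + 1)) :=
    eval_motzkin_succ_pos (by positivity) n
  rw [avStates, average, card_ofSize_eq, div_le_iff₀ (by positivity)]
  refine (Finset.sum_le_sum fun α _ => ?_).trans
    ((sum_refinedBound_add_three_le hδ k n hk).trans (le_of_eq (by ring)))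
  have h : numStates α.pdAutomaton ≤ α.refinedBound + 3 :=
    α.numStates_pdAutomaton_le.trans (by linarith [α.ncard_support_le_refinedBound])
  exact_mod_cast h

theorem avL_succ (k n : ℕ) :
    avL k (n + 1) = (k : ℝ) / (k + 1) * meanLeaves (3 * ((k : ℝ) + 1)) n := by
  have hM : 0 < (motzkin (n + 1)).eval (3 * ((k : ℝ) + 1)) :=
    eval_motzkin_succ_pos (by positivity) n
  have hK : (k : ℝ) + 1 ≠ 0 := by positivity
  rw [avL, average, card_ofSize_eq, sum_letters, meanLeaves]
  field_simp

/-- The quotient of the numbers of leaf labels in the two Motzkin polynomial values whose quotient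
is `avP / 3 + 1`. -/
noncomputable def leafRatio (k : ℕ) : ℝ := 1 + (k : ℝ) / (3 * (k + 1))

theorem one_le_leafRatio (k : ℕ) : 1 ≤ leafRatio k := by
  have : (0 : ℝ) ≤ (k : ℝ) / (3 * (k + 1)) := by positivity
  unfold leafRatio
  linarith

theorem leafRatio_le (k : ℕ) : leafRatio k ≤ 4 / 3 := by
  have : (k : ℝ) / (3 * (k + 1)) ≤ 1 / 3 := by
    rw [div_le_div_iff₀ (by positivity) (by norm_num)]
    linarith
  unfold leafRatio
  linarith

theorem avP_succ (k n : ℕ) :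
    avP k (n + 1) = 3 * ((motzkin (n + 1)).eval (leafRatio k * (3 * ((k : ℝ) + 1))) /
      (motzkin (n + 1)).eval (3 * ((k : ℝ) + 1))) - 3 := by
  have hM : 0 < (motzkin (n + 1)).eval (3 * ((k : ℝ) + 1)) :=
    eval_motzkin_succ_pos (by positivity) n
  have hK : (k : ℝ) + 1 ≠ 0 := by positivity
  have h := sum_supportBound_add_three k (n + 1)
  rw [Finset.sum_add_distrib, Finset.sum_const, nsmul_eq_mul, card_ofSize_eq] at h
  have e : leafRatio k * (3 * ((k : ℝ) + 1)) = (k : ℝ) + 3 * ((k : ℝ) + 1) := by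
    unfold leafRatio
    field_simp
    ring
  rw [avP, average, card_ofSize_eq, e, ← h]
  field_simp
  ring

theorem avP_succ_le (k n : ℕ) : avP k (n + 1) ≤ 3 * (4 / 3 : ℝ) ^ (((n : ℝ) + 2) / 2) := by
  have ht : (0 : ℝ) < 3 * ((k : ℝ) + 1) := by positivity
  have hM := eval_motzkin_succ_pos ht n
  have h := eval_motzkin_mul_le ht (one_le_leafRatio k) n
  rw [← div_le_iff₀ hM] at h
  have h' : leafRatio k ^ (((n : ℝ) + 2) / 2) ≤ (4 / 3 : ℝ) ^ (((n : ℝ) + 2) / 2) :=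
    Real.rpow_le_rpow (by linarith [one_le_leafRatio k]) (leafRatio_le k) (by positivity)
  rw [avP_succ]
  linarith

theorem le_avP_succ (k n : ℕ) :
    3 * leafRatio k ^ meanLeaves (3 * ((k : ℝ) + 1)) n - 3 ≤ avP k (n + 1) := by
  have ht : (0 : ℝ) < 3 * ((k : ℝ) + 1) := by positivity
  have hM := eval_motzkin_succ_pos ht n
  have h := rpow_meanLeaves_mul_le ht (lt_of_lt_of_le one_pos (one_le_leafRatio k)) n
  rw [← le_div_iff₀ hM] at h
  rw [avP_succ]
  linarith

/-! ### Asymptotics -/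

theorem tendsto_div_add_one : Tendsto (fun k : ℕ => (k : ℝ) / (k + 1)) atTop (𝓝 1) :=
  tendsto_natCast_div_add_atTop 1

theorem tendsto_leafRatio : Tendsto leafRatio atTop (𝓝 (4 / 3)) := by
  have h := (tendsto_div_add_one.const_mul (1 / 3 : ℝ)).const_add 1
  rw [show (1 : ℝ) + 1 / 3 * 1 = 4 / 3 by norm_num] at h
  refine h.congr fun k => ?_
  have : (k : ℝ) + 1 ≠ 0 := by positivity
  unfold leafRatio
  field_simp

theorem tendsto_natCast_succ_div : Tendsto (fun n : ℕ => ((n : ℝ) + 1) / n) atTop (𝓝 1) := by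
  have h := tendsto_one_div_atTop_nhds_zero_nat.const_add (1 : ℝ)
  rw [add_zero] at h
  refine h.congr' ?_
  filter_upwards [eventually_gt_atTop 0] with n hn
  have : (n : ℝ) ≠ 0 := by positivity
  field_simp

/-- In the limit, half of the symbols are leaves. -/
theorem tendsto_meanLeaves_div :
    Tendsto (fun nk : ℕ × ℕ => meanLeaves (3 * ((nk.2 : ℝ) + 1)) (nk.1 - 1) / nk.1)
      (atTop ×ˢ atTop) (𝓝 (1 / 2)) := by
  have hlow : Tendsto (fun nk : ℕ × ℕ => (1 - 2 / √(3 * ((nk.2 : ℝ) + 1))) / 2)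
      (atTop ×ˢ atTop) (𝓝 (1 / 2)) := by
    have h₁ : Tendsto (fun k : ℕ => √(3 * ((k : ℝ) + 1))) atTop atTop :=
      Real.tendsto_sqrt_atTop.comp ((tendsto_natCast_atTop_atTop.atTop_add
        tendsto_const_nhds).const_mul_atTop (by norm_num))
    have h₂ := ((h₁.const_div_atTop 2).const_sub 1).div_const 2
    rw [sub_zero] at h₂
    exact h₂.comp tendsto_snd
  have hup : Tendsto (fun nk : ℕ × ℕ => ((nk.1 : ℝ) + 1) / nk.1 / 2)
      (atTop ×ˢ atTop) (𝓝 (1 / 2)) :=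
    (tendsto_natCast_succ_div.div_const 2).comp tendsto_fst
  have hev : ∀ᶠ nk : ℕ × ℕ in atTop ×ˢ atTop, 0 < nk.1 :=
    tendsto_fst.eventually (eventually_gt_atTop 0)
  refine tendsto_of_tendsto_of_tendsto_of_le_of_le' hlow hup ?_ ?_
  · filter_upwards [hev] with ⟨n, k⟩ hn
    obtain ⟨n, rfl⟩ := Nat.exists_eq_add_of_le' (show 1 ≤ n from hn)
    have h := le_meanLeaves (t := 3 * ((k : ℝ) + 1)) (by positivity) n
    simp only [Nat.add_sub_cancel]
    have hs : 0 ≤ 2 / √(3 * ((k : ℝ) + 1)) := by positivity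
    rw [le_div_iff₀ (by positivity)]
    refine le_trans ?_ h
    push_cast
    rw [mul_div_right_comm 2 (n : ℝ)]
    linarith
  · filter_upwards [hev] with ⟨n, k⟩ hn
    obtain ⟨n, rfl⟩ := Nat.exists_eq_add_of_le' (show 1 ≤ n from hn)
    have h := meanLeaves_le (t := 3 * ((k : ℝ) + 1)) (by positivity) n
    simp only [Nat.add_sub_cancel]
    rw [div_right_comm]
    refine div_le_div_of_nonneg_right (h.trans (le_of_eq ?_)) (Nat.cast_nonneg _)
    push_cast
    ring

theorem tendsto_avL_div :
    Tendsto (fun nk : ℕ × ℕ => avL nk.2 nk.1 / nk.1) (atTop ×ˢ atTop) (𝓝 (1 / 2)) := by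
  have h := (tendsto_div_add_one.comp tendsto_snd).mul tendsto_meanLeaves_div
  rw [one_mul] at h
  refine h.congr' ?_
  filter_upwards [tendsto_fst.eventually (eventually_gt_atTop 0)] with ⟨n, k⟩ hn
  obtain ⟨n, rfl⟩ := Nat.exists_eq_add_of_le' (show 1 ≤ n from hn)
  simp only [Nat.add_sub_cancel, avL_succ, Function.comp]
  ring

theorem tendsto_log_leafRatio_mul_meanLeaves_div :
    Tendsto (fun nk : ℕ × ℕ => Real.log (leafRatio nk.2) *
      (meanLeaves (3 * ((nk.2 : ℝ) + 1)) (nk.1 - 1) / nk.1))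
      (atTop ×ˢ atTop) (𝓝 (Real.log (4 / 3) * (1 / 2))) :=
  (((Real.continuousAt_log (by norm_num)).tendsto.comp tendsto_leafRatio).comp tendsto_snd).mul
    tendsto_meanLeaves_div

theorem log_four_thirds_pos : 0 < Real.log (4 / 3) := Real.log_pos (by norm_num)

theorem tendsto_fst_cast_atTop :
    Tendsto (fun nk : ℕ × ℕ => (nk.1 : ℝ)) (atTop ×ˢ atTop) atTop :=
  tendsto_natCast_atTop_atTop.comp tendsto_fst

theorem eventually_rpow_le_avP :
    ∀ᶠ nk : ℕ × ℕ in atTop ×ˢ atTop,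
      leafRatio nk.2 ^ meanLeaves (3 * ((nk.2 : ℝ) + 1)) (nk.1 - 1) ≤ avP nk.2 nk.1 := by
  have h := tendsto_log_leafRatio_mul_meanLeaves_div.pos_mul_atTop
    (mul_pos log_four_thirds_pos (by norm_num)) tendsto_fst_cast_atTop
  filter_upwards [h.eventually_ge_atTop 1, tendsto_fst.eventually (eventually_gt_atTop 0)]
    with ⟨n, k⟩ h₁ hn
  obtain ⟨n, rfl⟩ := Nat.exists_eq_add_of_le' (show 1 ≤ n from hn)
  have hn' : ((n + 1 : ℕ) : ℝ) ≠ 0 := by positivity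
  have hpos : 0 < leafRatio k := lt_of_lt_of_le one_pos (one_le_leafRatio k)
  simp only [Nat.add_sub_cancel] at h₁ ⊢
  rw [mul_assoc, div_mul_cancel₀ _ hn'] at h₁
  have h₂ := le_avP_succ k n
  have h₃ : 2 ≤ leafRatio k ^ meanLeaves (3 * ((k : ℝ) + 1)) n := by
    rw [Real.rpow_def_of_pos hpos]
    linarith [Real.add_one_le_exp (Real.log (leafRatio k) * meanLeaves (3 * ((k : ℝ) + 1)) n)]
  linarith

theorem eventually_avP_pos : ∀ᶠ nk : ℕ × ℕ in atTop ×ˢ atTop, 0 < avP nk.2 nk.1 := by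
  filter_upwards [eventually_rpow_le_avP] with nk h
  exact lt_of_lt_of_le (Real.rpow_pos_of_pos (lt_of_lt_of_le one_pos (one_le_leafRatio _)) _) h

theorem tendsto_log_avP_div :
    Tendsto (fun nk : ℕ × ℕ => Real.log (avP nk.2 nk.1) / nk.1) (atTop ×ˢ atTop)
      (𝓝 (Real.log (4 / 3) * (1 / 2))) := by
  have hup : Tendsto (fun nk : ℕ × ℕ => Real.log 3 / (nk.1 : ℝ) +
      Real.log (4 / 3) * (((nk.1 : ℝ) + 1) / nk.1 / 2)) (atTop ×ˢ atTop)
      (𝓝 (Real.log (4 / 3) * (1 / 2))) := by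
    have h := (tendsto_fst_cast_atTop.const_div_atTop (Real.log 3)).add
      (((tendsto_natCast_succ_div.div_const 2).const_mul (Real.log (4 / 3))).comp
        (tendsto_fst (f := atTop) (g := (atTop : Filter ℕ))))
    rw [zero_add] at h
    exact h
  refine tendsto_of_tendsto_of_tendsto_of_le_of_le' tendsto_log_leafRatio_mul_meanLeaves_div hup
    ?_ ?_
  · filter_upwards [eventually_rpow_le_avP] with nk h
    have hpos : 0 < leafRatio nk.2 := lt_of_lt_of_le one_pos (one_le_leafRatio _)
    have h' := Real.log_le_log (Real.rpow_pos_of_pos hpos _) h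
    rw [Real.log_rpow hpos] at h'
    rw [← mul_div_assoc, mul_comm (Real.log _)]
    exact div_le_div_of_nonneg_right h' (Nat.cast_nonneg _)
  · filter_upwards [eventually_avP_pos, tendsto_fst.eventually (eventually_gt_atTop 0)]
      with ⟨n, k⟩ hpos hn
    obtain ⟨n, rfl⟩ := Nat.exists_eq_add_of_le' (show 1 ≤ n from hn)
    have h := Real.log_le_log hpos (avP_succ_le k n)
    rw [Real.log_mul (by norm_num) (by positivity), Real.log_rpow (by norm_num)] at h
    have hn' : (0 : ℝ) < ((n + 1 : ℕ) : ℝ) := by positivity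
    rw [div_le_iff₀ hn']
    refine h.trans (le_of_eq ?_)
    field_simp
    push_cast
    ring

theorem tendsto_log_avP_div_avL :
    Tendsto (fun nk : ℕ × ℕ => Real.log (avP nk.2 nk.1) / avL nk.2 nk.1) (atTop ×ˢ atTop)
      (𝓝 (Real.log (4 / 3))) := by
  have h := tendsto_log_avP_div.div tendsto_avL_div (by norm_num)
  rw [mul_div_cancel_right₀ _ (by norm_num)] at h
  refine h.congr' ?_
  filter_upwards [tendsto_fst.eventually (eventually_gt_atTop 0)] with nk hn
  have : (nk.1 : ℝ) ≠ 0 := by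
    have : nk.1 ≠ 0 := Nat.pos_iff_ne_zero.mp hn
    exact_mod_cast this
  exact div_div_div_cancel_right₀ this _ _

/-- The logarithm of the bound of `avStates_succ_le`, divided by the size. -/
theorem tendsto_log_bound_div (δ : ℝ) :
    Tendsto (fun n : ℕ => (Real.log 6 + 3 * Real.log n + ((n : ℝ) + 1) / 2 * Real.log (53 / 40) +
      (δ * n + 1) * Real.log 250) / n) atTop
      (𝓝 (Real.log (53 / 40) / 2 + δ * Real.log 250)) := by
  have hlog : Tendsto (fun n : ℕ => Real.log n / n) atTop (𝓝 0) :=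
    (Real.isLittleO_log_id_atTop.tendsto_div_nhds_zero).comp tendsto_natCast_atTop_atTop
  have h := ((((tendsto_natCast_atTop_atTop (R := ℝ)).const_div_atTop
    (Real.log 6 + Real.log (53 / 40) / 2 + Real.log 250)).add (hlog.const_mul 3)).add_const
    (Real.log (53 / 40) / 2 + δ * Real.log 250))
  rw [mul_zero, add_zero, zero_add] at h
  refine h.congr' ?_
  filter_upwards [eventually_gt_atTop 0] with n hn
  have : (n : ℝ) ≠ 0 := by positivity
  field_simp
  ring

theorem eventually_avStates_le :
    ∀ᶠ nk : ℕ × ℕ in atTop ×ˢ atTop, avStates nk.2 nk.1 ≤ (4 / 3 : ℝ) ^ avL nk.2 nk.1 := by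
  have h250 : 0 < Real.log 250 := Real.log_pos (by norm_num)
  have hgap : Real.log (53 / 40) < Real.log (4 / 3) :=
    Real.log_lt_log (by norm_num) (by norm_num)
  -- The gap between `53 / 40` and `4 / 3` pays for the factor `250 ^ (δ * n)`.
  obtain ⟨δ, hδ, hlt⟩ : ∃ δ : ℝ, 0 < δ ∧
      Real.log (53 / 40) / 2 + δ * Real.log 250 < Real.log (4 / 3) * (1 / 2) := by
    refine ⟨(Real.log (4 / 3) - Real.log (53 / 40)) / (4 * Real.log 250),
      div_pos (by linarith) (by positivity), ?_⟩
    have : (Real.log (4 / 3) - Real.log (53 / 40)) / (4 * Real.log 250) * Real.log 250 =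
        (Real.log (4 / 3) - Real.log (53 / 40)) / 4 := by
      field_simp
    rw [this]
    linarith
  have hk : ∀ᶠ k : ℕ in atTop, (250 : ℝ) ^ 2 ≤ δ ^ 2 * (3 * ((k : ℝ) + 1)) :=
    Tendsto.eventually_ge_atTop (Tendsto.const_mul_atTop (by positivity)
      ((tendsto_natCast_atTop_atTop.atTop_add tendsto_const_nhds).const_mul_atTop
        (by norm_num))) _
  have hev := Tendsto.eventually_lt ((tendsto_log_bound_div δ).comp
    (tendsto_fst (f := atTop) (g := (atTop : Filter ℕ))))
    (tendsto_avL_div.const_mul (Real.log (4 / 3))) hlt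
  filter_upwards [hev, tendsto_snd.eventually hk, tendsto_fst.eventually (eventually_gt_atTop 0)]
    with ⟨n, k⟩ h₁ h₂ hn
  obtain ⟨n, rfl⟩ := Nat.exists_eq_add_of_le' (show 1 ≤ n from hn)
  have hn' : (0 : ℝ) < ((n + 1 : ℕ) : ℝ) := by positivity
  refine (avStates_succ_le hδ k n h₂).trans ?_
  simp only [Function.comp] at h₁
  rw [← mul_div_assoc, div_lt_div_iff_of_pos_right hn'] at h₁
  have hpos : 0 < 6 * ((n : ℝ) + 1) ^ 3 * (53 / 40 : ℝ) ^ (((n : ℝ) + 2) / 2) *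
      (250 : ℝ) ^ (δ * n + 1) := by positivity
  rw [Real.rpow_def_of_pos (show (0 : ℝ) < 4 / 3 by norm_num), ← Real.log_le_iff_le_exp hpos,
    Real.log_mul (by positivity) (by positivity), Real.log_mul (by positivity) (by positivity),
    Real.log_mul (by norm_num) (by positivity), Real.log_pow, Real.log_rpow (by norm_num),
    Real.log_rpow (by norm_num)]
  refine le_trans ?_ h₁.le
  push_cast
  have : δ * (n : ℝ) * Real.log 250 ≤ δ * ((n : ℝ) + 1) * Real.log 250 := by
    gcongr
    linarith
  linarith

end ShuffleExpr

theorem mainTheorem2 :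
    (∀ (k : ℕ) (α : ShuffleExpr (Fin k)),
      α.support.Finite ∧ α.support.ncard ≤ α.supportBound ∧
      Finite α.pderivs ∧ ShuffleExpr.numStates α.pdAutomaton ≤ α.supportBound + 1) ∧
    Tendsto
      (fun nk : ℕ × ℕ =>
        Real.logb 2 (ShuffleExpr.avP nk.2 nk.1) / ShuffleExpr.avL nk.2 nk.1)
      (atTop ×ˢ atTop) (𝓝 (Real.logb 2 (4 / 3))) ∧
    Tendsto
      (fun nk : ℕ × ℕ =>
        (ShuffleExpr.avP nk.2 nk.1) ^ (1 / ShuffleExpr.avL nk.2 nk.1))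
      (atTop ×ˢ atTop) (𝓝 (4 / 3 : ℝ)) ∧
    ∃ N K : ℕ, ∀ n k : ℕ, N ≤ n → K ≤ k →
      ShuffleExpr.avStates k n ≤ (4 / 3 : ℝ) ^ ShuffleExpr.avL k n := by
  refine ⟨fun k α => ⟨α.finite_support, α.ncard_support_le_supportBound, α.finite_pderivs,
    α.numStates_pdAutomaton_le.trans
      (Nat.add_le_add_right α.ncard_support_le_supportBound 1)⟩, ?_, ?_, ?_⟩
  · refine (ShuffleExpr.tendsto_log_avP_div_avL.div_const (Real.log 2)).congr fun nk => ?_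
    rw [Real.logb, div_right_comm]
  · have h := (Real.continuous_exp.tendsto _).comp ShuffleExpr.tendsto_log_avP_div_avL
    rw [Real.exp_log (by norm_num)] at h
    refine h.congr' ?_
    filter_upwards [ShuffleExpr.eventually_avP_pos] with nk hpos
    rw [Real.rpow_def_of_pos hpos, mul_one_div]
    rfl
  · have h := ShuffleExpr.eventually_avStates_le
    rw [prod_atTop_atTop_eq, eventually_atTop] at h
    obtain ⟨⟨N, K⟩, h⟩ := h
    exact ⟨N, K, fun n k hn hk => h (n, k) ⟨hn, hk⟩⟩
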